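/- Let $F$ be $\mathbb R$ or $\mathbb C$, with normalized absolute value $|\cdot|$ ($|x|$ is the usual one for $F=\mathbb R$, and $|z|=z\bar z$ for $F=\mathbb C$). Let $n$ be a natural number, $G=GL_{2n}(F)$, let $K$ be its standard maximal compact subgroup ($O(2n)$ if $F=\mathbb R$, $U(2n)$ if $F=\mathbb C$), let $T\subset G$ be the torus of diagonal matrices, also regarded as the subset $(F^\times)^{2n}$ of $F^{2n}$, and let $N$ be the group of upper triangular matrices with unit diagonal. Put $\delta_B(t)=\prod_{i<j}|t_i/t_j|$ for $t\in T$. Fix Haar measures on $G$, $T$ and $K$. Let $\chi:T\to\mathbb C^\times$ be a continuous character, and let $(\pi,V)$ be the corresponding principal series representation: $V=V_\chi$ is the space of smooth functions $f:G\to\mathbb C$ with $f(tg)=\chi(t)\delta_B(t)^{1/2}f(g)$ and $f(ug)=f(g)$ for all $t\in T$, $u\in N$, $g\in G$, and $G$ acts by right translation, $(\pi(g)f)(x)=f(xg)$. Let $\widetilde V$ be its contragredient, realized as the principal series $V_{\chi^{-1}}$, where $w\in V_{\chi^{-1}}$ is regarded as the linear functional $v\mapsto\int_K v(k)w(k)\,dk$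 on $V$. Let $v\in V$, $\xi\in\widetilde V$, and let $\Phi$ be a Schwartz function on $\operatorname{Mat}(2n\times 2n,F)$. Then there exists a Schwartz function $\phi\in\mathcal S(F^{2n})$ such that for every $s\in\mathbb C$ for which the integral $$\int_T\phi(t)\chi(t)|\det t|^s\,dt$$ converges absolutely, the integral on the left below also converges absolutely and $$\int_G\Phi(g)\,\xi(\pi(g)v)\,|\det g|^{s+n-\frac12}\,dg=\int_T\phi(t)\chi(t)|\det t|^s\,dt .$$ -/

import Mathlib

open MeasureTheory
open scoped ContDiff SchwartzMap MatrixGroups Matrix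

-- `Mat(m × m, F)` as a finite-dimensional real normed space, with the sup norm of the entries;
-- the spaces of smooth and of Schwartz functions do not depend on the choice of the norm.
attribute [local instance] Matrix.normedAddCommGroup Matrix.normedSpace

namespace GodementJacquet

noncomputable section

/-- The normalized absolute value (module) of the archimedean local field `F`:
the usual one for `F = ℝ`, and `z ↦ z * conj z`, the square of the usual one, for `F = ℂ`. -/
def modAbs {F : Type*} [RCLike F] (x : F) : ℝ := ‖x‖ ^ Module.finrank ℝ F

/-- The group `GL_m(F)` carries its Borel σ-algebra. -/
instance instMeasurableSpaceGL {F : Type*} [RCLike F] {m : ℕ} : MeasurableSpace (GL (Fin m) F) :=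
  borel _

instance instBorelSpaceGL {F : Type*} [RCLike F] {m : ℕ} : BorelSpace (GL (Fin m) F) := ⟨rfl⟩

/-- The torus `(Fˣ)^m`, as a topological group. -/
abbrev Torus (F : Type*) [RCLike F] (m : ℕ) : Type _ := Fin m → Fˣ

/-- The embedding of the torus `(Fˣ)^m` in `GL_m(F)` as the group of diagonal matrices. -/
def diag {F : Type*} [RCLike F] {m : ℕ} : Torus F m →* GL (Fin m) F :=
  (Units.map (Matrix.diagonalRingHom (Fin m) F).toMonoidHom).comp
    (MulEquiv.piUnits (M := fun _ : Fin m => F)).symm.toMonoidHom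

/-- `u` is an upper triangular matrix with unit diagonal. -/
def IsUpperUnipotent {F : Type*} [RCLike F] {m : ℕ} (u : GL (Fin m) F) : Prop :=
  (∀ i j, j < i → (u : Matrix (Fin m) (Fin m) F) i j = 0) ∧
    ∀ i, (u : Matrix (Fin m) (Fin m) F) i i = 1

/-- The module `δ_B` of the Borel group of upper triangular matrices, on the diagonal torus:
`δ_B(t)` is the module of the action of `t` by conjugation on the space of strictly upper
triangular matrices, i.e. the product of the `|t_i / t_j|` over `i < j`. -/
def deltaB {F : Type*} [RCLike F] {m : ℕ} (t : Torus F m) : ℝ :=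
  ∏ i : Fin m, ∏ j ∈ Finset.Ioi i, modAbs ((t i : F) / (t j : F))

/-- A function on `GL_m(F)` is smooth, as a function on the open subset `det ≠ 0` of the real
vector space `Mat(m × m, F)`. -/
def IsSmooth {F : Type*} [RCLike F] {m : ℕ} (f : GL (Fin m) F → ℂ) : Prop :=
  ContDiffOn ℝ ∞ (Function.extend (fun g : GL (Fin m) F => (g : Matrix (Fin m) (Fin m) F)) f 0)
    {A | A.det ≠ 0}

theorem extend_coe {F : Type*} [RCLike F] {m : ℕ} (f : GL (Fin m) F → ℂ) (g : GL (Fin m) F) :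
    Function.extend (fun g : GL (Fin m) F => (g : Matrix (Fin m) (Fin m) F)) f 0
      (g : Matrix (Fin m) (Fin m) F) = f g :=
  Function.Injective.extend_apply (fun _ _ h => Units.ext h) f 0 g

theorem exists_coe {F : Type*} [RCLike F] {m : ℕ} {A : Matrix (Fin m) (Fin m) F}
    (hA : A.det ≠ 0) : ∃ g : GL (Fin m) F, (g : Matrix (Fin m) (Fin m) F) = A :=
  ⟨Matrix.GeneralLinearGroup.mkOfDetNeZero A hA, rfl⟩

theorem IsSmooth.congr_of {F : Type*} [RCLike F] {m : ℕ} {f : GL (Fin m) F → ℂ}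
    {h : Matrix (Fin m) (Fin m) F → ℂ} (hh : ContDiffOn ℝ ∞ h {A | A.det ≠ 0})
    (hf : ∀ g : GL (Fin m) F, f g = h (g : Matrix (Fin m) (Fin m) F)) : IsSmooth f := by
  refine hh.congr fun A hA => ?_
  obtain ⟨g, rfl⟩ := exists_coe hA
  rw [extend_coe, hf]

theorem IsSmooth.right_translate {F : Type*} [RCLike F] {m : ℕ} {f : GL (Fin m) F → ℂ}
    (hf : IsSmooth f) (g : GL (Fin m) F) : IsSmooth fun x => f (x * g) := by
  have hL : ContDiff ℝ ∞ (fun A : Matrix (Fin m) (Fin m) F =>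
      A * (g : Matrix (Fin m) (Fin m) F)) :=
    (LinearMap.toContinuousLinearMap
      (LinearMap.mulRight ℝ (g : Matrix (Fin m) (Fin m) F))).contDiff
  refine IsSmooth.congr_of (hf.comp hL.contDiffOn ?_) fun x => ?_
  · intro A hA
    obtain ⟨x, rfl⟩ := exists_coe hA
    exact ((x * g).isUnit.map Matrix.detMonoidHom).ne_zero
  · exact (extend_coe f (x * g)).symm

/-- The space of the (normalized, smooth) principal series representation of `GL_m(F)` attached
to the character `χ` of the diagonal torus: the smooth functions `f` on `GL_m(F)` with
`f (t g) = χ(t) δ_B(t)^{1/2} f(g)` for `t` diagonal and `f (u g) = f(g)` for `u` upper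
triangular with unit diagonal. -/
def principalSeriesSpace {F : Type*} [RCLike F] {m : ℕ} (χ : Torus F m →ₜ* ℂˣ) :
    Submodule ℂ (GL (Fin m) F → ℂ) where
  carrier := {f | IsSmooth f ∧
    (∀ t g, f (diag t * g) = (χ t : ℂ) * (Real.sqrt (deltaB t) : ℂ) * f g) ∧
    ∀ u g, IsUpperUnipotent u → f (u * g) = f g}
  zero_mem' := by
    refine ⟨IsSmooth.congr_of (h := fun _ => 0) contDiffOn_const fun _ => rfl, ?_, ?_⟩ <;> simp
  add_mem' := by
    rintro a b ⟨ha, ha1, ha2⟩ ⟨hb, hb1, hb2⟩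
    refine ⟨IsSmooth.congr_of (ha.add hb) fun g => ?_, fun t g => ?_, fun u g hu => ?_⟩
    · simp only [Pi.add_apply, extend_coe]
    · simp only [Pi.add_apply, ha1, hb1, mul_add]
    · simp only [Pi.add_apply, ha2 u g hu, hb2 u g hu]
  smul_mem' := by
    rintro c a ⟨ha, ha1, ha2⟩
    refine ⟨IsSmooth.congr_of (ha.const_smul c) fun g => ?_, fun t g => ?_, fun u g hu => ?_⟩
    · simp only [Pi.smul_apply, extend_coe]
    · simp only [Pi.smul_apply, ha1, smul_eq_mul]; ring
    · simp only [Pi.smul_apply, ha2 u g hu]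

/-- The principal series representation: `GL_m(F)` acts by right translation,
`(π(g) f)(x) = f(x g)`. -/
def principalSeries {F : Type*} [RCLike F] {m : ℕ} (χ : Torus F m →ₜ* ℂˣ) :
    Representation ℂ (GL (Fin m) F) (principalSeriesSpace χ) where
  toFun g :=
    { toFun := fun f => ⟨fun x => f.1 (x * g), f.2.1.right_translate g,
        fun t x => by simpa only [mul_assoc] using f.2.2.1 t (x * g),
        fun u x hu => by simpa only [mul_assoc] using f.2.2.2 u (x * g) hu⟩
      map_add' := fun _ _ => rfl
      map_smul' := fun _ _ => rfl }
  map_one' := by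
    ext f x
    simp
  map_mul' g h := by
    ext f x
    simp [mul_assoc]

/-- The standard maximal compact subgroup `K` of `GL_m(F)`: the matrices `k` with `kᴴ k = 1`,
so `O(m)` for `F = ℝ` and `U(m)` for `F = ℂ`. -/
def maxCompact (F : Type*) [RCLike F] (m : ℕ) : Subgroup (GL (Fin m) F) where
  carrier := {k | (k : Matrix (Fin m) (Fin m) F)ᴴ * (k : Matrix (Fin m) (Fin m) F) = 1}
  one_mem' := by simp
  mul_mem' := by
    intro a b ha hb
    simp only [Set.mem_ofPred_eq] at ha hb ⊢
    rw [Units.val_mul, Matrix.conjTranspose_mul, Matrix.mul_assoc,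
      ← Matrix.mul_assoc _ (a : Matrix (Fin m) (Fin m) F), ha, Matrix.one_mul, hb]
  inv_mem' := by
    intro a ha
    simp only [Set.mem_ofPred_eq] at ha ⊢
    have h : (a : Matrix (Fin m) (Fin m) F)ᴴ = ((a⁻¹ : GL (Fin m) F) : Matrix _ _ F) :=
      (Units.inv_eq_of_mul_eq_one_left ha).symm
    rw [← h, Matrix.conjTranspose_conjTranspose, h, Units.mul_inv]

/-- `ξ` belongs to the contragredient `Ṽ` of the principal series `V` attached to `χ`, realized
as the principal series attached to `χ⁻¹`: a vector `w` of the latter is regarded as the linear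
functional `v ↦ ∫_K v(k) w(k) dk` on `V`. Here `μK` is a Haar measure on `K`; changing it only
rescales the functionals. -/
def IsContragredientVector {F : Type*} [RCLike F] {m : ℕ} (χ : Torus F m →ₜ* ℂˣ)
    (μK : Measure (maxCompact F m)) (ξ : Module.Dual ℂ (principalSeriesSpace χ)) : Prop :=
  ∃ w : principalSeriesSpace χ⁻¹, ∀ v : principalSeriesSpace χ,
    ξ v = ∫ k : maxCompact F m, v.1 k * w.1 k ∂μK

end

end GodementJacquet

/-! In the Iwasawa decomposition `G = BK`, a left Haar measure of `B` times Haar measure on `K`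
gives a Haar measure of `G`. Write the matrix coefficient as an integral over `k₁ ∈ K`, replace `g`
by `k₁⁻¹ g`, and put `g = b k₂`, where `b` has diagonal `t` and strictly upper part `X`. Then `v` is
evaluated at `b k₂` and contributes `χ(t) δ_B(t)^{1/2} v(k₂)`. The density of the Haar measure,
`δ_B^{1/2}` and the shift `|det|^{n-1/2}` cancel exactly (`borelDensity_mul_sqrt_deltaB`). What
remains is the torus integral of `φ(t) χ(t) |det t|^s`, where `φ(x)` is, up to a constant, the
integral of `w(k₁) v(k₂) Φ(k₁⁻¹ (diag x + X) k₂)` over `k₁`, `k₂`, `X`. Since `K` is compact and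
preserves the Hilbert–Schmidt norm, `Φ` decays in `x` and `X` uniformly in `k₁`, `k₂`, so `φ` is
Schwartz (`exists_schwartzMap_sphericalKernel`).

Fubini justifies this when some negative power of `1 + ‖t‖` is integrable against the torus weight
(`exists_schwartzMap_zeta_eq`). With `|χ(t)| = ∏ |t_i|^{σ_i}` (usual absolute values), this holds
once every `σ_i + [F:ℝ] Re s` is positive. But the torus integral of this particular `φ` may
converge at other `s`, if `φ` vanishes on a coordinate hyperplane, and nothing is known there. The
remedy is to choose `φ` well: let `i` minimise `σ_i`, and let `p` have `i`-th coordinate `0` and all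
others `1`. If `φ(p) ≠ 0`, convergence forces the positivity (`exponent_pos_of_integrable`). If
`φ(p) = 0`, add a Schwartz function that is nonzero at `p` and whose torus integral vanishes by a
sign symmetry in a second coordinate (`exists_schwartzMap_zeta_eq_zero`). -/

namespace GodementJacquet

noncomputable section

/-! ### Topology of `GL_m(F)` and a compact neighbourhood bi-invariant under `K`. -/

section

variable {F : Type*} [RCLike F] {m : ℕ}

instance instBorelSpaceUnits : BorelSpace Fˣ :=
  ⟨by
    have h : Topology.IsInducing (Units.val : Fˣ → F) := Units.isEmbedding_val₀.isInducing
    have e : (Units.instMeasurableSpace : MeasurableSpace Fˣ) =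
      MeasurableSpace.comap Units.val (borel F) := by
      rw [← BorelSpace.measurable_eq (α := F)]; rfl
    exact e.trans (borel_comap.symm.trans (congrArg (@borel Fˣ) h.eq_induced.symm))⟩

instance instSecondCountableUnits : SecondCountableTopology Fˣ :=
  Units.isEmbedding_val₀.secondCountableTopology

instance instSecondCountableMatrix : SecondCountableTopology (Matrix (Fin m) (Fin m) F) :=
  inferInstanceAs (SecondCountableTopology (Fin m → Fin m → F))

instance instLocallyCompactMatrix : LocallyCompactSpace (Matrix (Fin m) (Fin m) F) :=
  inferInstanceAs (LocallyCompactSpace (Fin m → Fin m → F))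

instance instSecondCountableGL : SecondCountableTopology (GL (Fin m) F) := by
  have : SecondCountableTopology (Matrix (Fin m) (Fin m) F)ᵐᵒᵖ :=
    MulOpposite.opHomeomorph.symm.isEmbedding.secondCountableTopology
  exact (Units.isEmbedding_embedProduct (M := Matrix (Fin m) (Fin m) F)).secondCountableTopology

instance instSecondCountableMaxCompact : SecondCountableTopology (maxCompact F m) :=
  TopologicalSpace.Subtype.secondCountableTopology _

instance instLocallyCompactGL : LocallyCompactSpace (GL (Fin m) F) :=
  inferInstanceAs (LocallyCompactSpace (Matrix (Fin m) (Fin m) F)ˣ)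

/-- The square of the Hilbert–Schmidt norm. -/
def hsNormSq (A : Matrix (Fin m) (Fin m) F) : ℝ := ∑ i, ∑ j, ‖A i j‖ ^ 2

theorem hsNormSq_eq_trace (A : Matrix (Fin m) (Fin m) F) :
    (hsNormSq A : F) = (Aᴴ * A).trace := by
  rw [hsNormSq, Finset.sum_comm]
  simp only [Matrix.trace, Matrix.diag, Matrix.mul_apply, Matrix.conjTranspose_apply]
  push_cast
  refine Finset.sum_congr rfl fun i _ => Finset.sum_congr rfl fun j _ => ?_
  rw [RCLike.star_def, RCLike.conj_mul]

theorem hsNormSq_left (k : maxCompact F m) (A : Matrix (Fin m) (Fin m) F) :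
    hsNormSq ((k : GL (Fin m) F).val * A) = hsNormSq A := by
  have hk : (k : GL (Fin m) F).valᴴ * (k : GL (Fin m) F).val = 1 := k.2
  have : (hsNormSq ((k : GL (Fin m) F).val * A) : F) = hsNormSq A := by
    rw [hsNormSq_eq_trace, hsNormSq_eq_trace, Matrix.conjTranspose_mul, Matrix.mul_assoc,
      ← Matrix.mul_assoc _ _ A, hk, Matrix.one_mul]
  exact_mod_cast this

theorem mul_conjTranspose_maxCompact (k : maxCompact F m) :
    (k : GL (Fin m) F).val * (k : GL (Fin m) F).valᴴ = 1 := by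
  have hk : (k : GL (Fin m) F).valᴴ * (k : GL (Fin m) F).val = 1 := k.2
  exact mul_eq_one_comm.mp hk

theorem hsNormSq_right (k : maxCompact F m) (A : Matrix (Fin m) (Fin m) F) :
    hsNormSq (A * (k : GL (Fin m) F).val) = hsNormSq A := by
  have : (hsNormSq (A * (k : GL (Fin m) F).val) : F) = hsNormSq A := by
    rw [hsNormSq_eq_trace, hsNormSq_eq_trace, Matrix.conjTranspose_mul, Matrix.mul_assoc,
      Matrix.trace_mul_comm, ← Matrix.mul_assoc, Matrix.mul_assoc,
      mul_conjTranspose_maxCompact, Matrix.mul_one]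
  exact_mod_cast this

theorem norm_sq_le_hsNormSq (A : Matrix (Fin m) (Fin m) F) (i j : Fin m) :
    ‖A i j‖ ^ 2 ≤ hsNormSq A := by
  refine le_trans ?_ (Finset.single_le_sum (f := fun i => ∑ j, ‖A i j‖ ^ 2)
    (fun i _ => Finset.sum_nonneg fun j _ => by positivity) (Finset.mem_univ i))
  exact Finset.single_le_sum (f := fun j => ‖A i j‖ ^ 2) (fun j _ => by positivity)
    (Finset.mem_univ j)

theorem continuous_hsNormSq : Continuous (hsNormSq : Matrix (Fin m) (Fin m) F → ℝ) := by
  unfold hsNormSq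
  refine continuous_finsetSum _ fun i _ => continuous_finsetSum _ fun j _ => ?_
  exact ((continuous_id.matrix_elem i j).norm).pow 2

theorem norm_le_of_hsNormSq_le {A : Matrix (Fin m) (Fin m) F} {R : ℝ} (hR : 0 ≤ R)
    (h : hsNormSq A ≤ R ^ 2) : ‖A‖ ≤ R := by
  rw [Matrix.norm_le_iff hR]
  intro i j
  exact abs_le_of_sq_le_sq' ((norm_sq_le_hsNormSq A i j).trans h) hR |>.2

/-- A compact neighbourhood of `1` in `GL_m(F)` that is bi-invariant under the maximal compact
subgroup and stable under inversion. -/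
def biBall (F : Type*) [RCLike F] (m : ℕ) : Set (GL (Fin m) F) :=
  {g | hsNormSq g.val ≤ ((m : ℝ) + 1) ^ 2 ∧ hsNormSq (g⁻¹).val ≤ ((m : ℝ) + 1) ^ 2}

theorem inv_mem_biBall {g : GL (Fin m) F} : g⁻¹ ∈ biBall F m ↔ g ∈ biBall F m := by
  simp [biBall, and_comm]

theorem mul_mem_biBall (k : maxCompact F m) {g : GL (Fin m) F} :
    g * k ∈ biBall F m ↔ g ∈ biBall F m := by
  have h : (g * (k : GL (Fin m) F))⁻¹ = ((k⁻¹ : maxCompact F m) : GL (Fin m) F) * g⁻¹ := by simp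
  simp only [biBall, Set.mem_ofPred_eq]
  rw [h, Units.val_mul, Units.val_mul, hsNormSq_right, hsNormSq_left]

theorem isCompact_biBall : IsCompact (biBall F m) := by
  have hc := (Units.isClosedEmbedding_embedProduct (α := Matrix (Fin m) (Fin m) F))
  set B : Set (Matrix (Fin m) (Fin m) F) := {A | hsNormSq A ≤ ((m : ℝ) + 1) ^ 2}
  have hB : IsCompact B := by
    refine (ProperSpace.isCompact_closedBall (0 : Matrix (Fin m) (Fin m) F) ((m : ℝ) + 1)).of_isClosed_subset
      (isClosed_le continuous_hsNormSq continuous_const) fun A hA => ?_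
    rw [mem_closedBall_zero_iff]
    exact norm_le_of_hsNormSq_le (by positivity) hA
  have h2 : IsCompact (B ×ˢ (MulOpposite.unop ⁻¹' B)) := by
    refine hB.prod ?_
    exact MulOpposite.opHomeomorph.symm.isClosedEmbedding.isCompact_preimage hB
  have := hc.isCompact_preimage h2
  exact this

theorem isClosed_biBall : IsClosed (biBall F m) := isCompact_biBall.isClosed

/-- The radius `m + 1` of `biBall` is chosen for this: the identity has square norm `m`, strictly
inside even for `m = 0`. -/
theorem hsNormSq_one_lt : hsNormSq (1 : Matrix (Fin m) (Fin m) F) < ((m : ℝ) + 1) ^ 2 := by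
  have : hsNormSq (1 : Matrix (Fin m) (Fin m) F) = m := by
    have h := hsNormSq_eq_trace (1 : Matrix (Fin m) (Fin m) F)
    simp only [Matrix.conjTranspose_one, mul_one, Matrix.trace_one, Fintype.card_fin] at h
    exact_mod_cast h
  rw [this]
  have : (0 : ℝ) ≤ m := Nat.cast_nonneg m
  nlinarith

theorem biBall_mem_nhds : biBall F m ∈ nhds (1 : GL (Fin m) F) := by
  have h1 : Continuous fun g : GL (Fin m) F => hsNormSq g.val :=
    continuous_hsNormSq.comp Units.continuous_val
  have h2 : Continuous fun g : GL (Fin m) F => hsNormSq (g⁻¹).val := h1.comp continuous_inv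
  filter_upwards [h1.continuousAt.eventually_lt continuousAt_const
      (show hsNormSq (1 : GL (Fin m) F).val < ((m : ℝ) + 1) ^ 2 from hsNormSq_one_lt),
    h2.continuousAt.eventually_lt continuousAt_const
      (show hsNormSq ((1 : GL (Fin m) F)⁻¹).val < ((m : ℝ) + 1) ^ 2 by
        rw [inv_one]; exact hsNormSq_one_lt)] with g hg hg'
  exact ⟨hg.le, hg'.le⟩

theorem isClosed_maxCompact : IsClosed (maxCompact F m : Set (GL (Fin m) F)) := by
  have : Continuous fun g : GL (Fin m) F => g.valᴴ * g.val :=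
    (Units.continuous_val.matrix_conjTranspose).mul Units.continuous_val
  exact isClosed_singleton.preimage this

instance instCompactSpaceMaxCompact : CompactSpace (maxCompact F m) := by
  refine (isCompact_iff_compactSpace (s := (maxCompact F m : Set (GL (Fin m) F)))).1 ?_
  refine isCompact_biBall.of_isClosed_subset isClosed_maxCompact fun k hk => ?_
  have := mul_mem_biBall (F := F) ⟨k, hk⟩ (g := 1)
  rw [one_mul] at this
  exact this.2 (mem_of_mem_nhds biBall_mem_nhds)

/-- The translated measure is left invariant, hence a multiple of `μG`. The factor is `1` because
`biBall` is stable under `K` and has finite positive measure. Full unimodularity of `GL_m(F)` is not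
needed. -/
theorem map_mul_right_maxCompact (μG : Measure (GL (Fin m) F)) [μG.IsHaarMeasure]
    (k : maxCompact F m) : μG.map (fun g => g * (k : GL (Fin m) F)) = μG := by
  have hmeas : Measurable fun g : GL (Fin m) F => g * (k : GL (Fin m) F) :=
    (continuous_mul_const _).measurable
  have h := Measure.isMulLeftInvariant_eq_smul (μG.map (fun g => g * (k : GL (Fin m) F))) μG
  have hS := congrArg (fun μ : Measure (GL (Fin m) F) => μ (biBall F m)) h
  beta_reduce at hS
  have hpre : (fun g : GL (Fin m) F => g * (k : GL (Fin m) F)) ⁻¹' biBall F m = biBall F m := by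
    ext g; exact mul_mem_biBall k
  rw [Measure.map_apply hmeas isClosed_biBall.measurableSet, hpre] at hS
  have h0 : μG (biBall F m) ≠ 0 := (Measure.measure_pos_of_mem_nhds μG biBall_mem_nhds).ne'
  have h1 : μG (biBall F m) ≠ ⊤ := isCompact_biBall.measure_lt_top.ne
  set c := (μG.map (fun g => g * (k : GL (Fin m) F))).haarScalarFactor μG
  have hc : c = 1 := by
    rw [Measure.smul_apply, ENNReal.smul_def, smul_eq_mul] at hS
    have : (c : ENNReal) = 1 := by
      refine (ENNReal.mul_left_inj h0 h1).1 ?_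
      rw [one_mul]; exact hS.symm
    exact_mod_cast this
  rw [h, hc, one_smul]

end

/-! ### Coordinates on upper triangular matrices and the Iwasawa decomposition. -/

section

variable {F : Type*} [RCLike F] {m : ℕ}

/-- Both sides are the factor by which multiplication by `x` scales Lebesgue measure, read off from
the image of the unit ball. This treats `ℝ` and `ℂ` at once. -/
theorem abs_norm_eq_modAbs (x : F) : |Algebra.norm ℝ x| = modAbs x := by
  rcases eq_or_ne x 0 with rfl | hx
  · rw [Algebra.norm_zero, modAbs, norm_zero, zero_pow Module.finrank_pos.ne', abs_zero]
  · have h := Measure.addHaar_image_linearMap (volume : Measure F) (LinearMap.mulLeft ℝ x)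
      (Metric.ball 0 1)
    have himg : (LinearMap.mulLeft ℝ x) '' Metric.ball 0 1 = Metric.ball 0 ‖x‖ := by
      rw [← smul_unitBall (E := F) hx]
      rfl
    rw [himg, Measure.addHaar_ball _ _ (norm_nonneg x)] at h
    have h0 : (volume : Measure F) (Metric.ball 0 1) ≠ 0 :=
      (Metric.measure_ball_pos _ _ one_pos).ne'
    have h1 : (volume : Measure F) (Metric.ball 0 1) ≠ ⊤ := measure_ball_lt_top.ne
    have h2 := (ENNReal.mul_left_inj h0 h1).1 h
    rw [ENNReal.ofReal_eq_ofReal_iff (by positivity) (abs_nonneg _)] at h2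
    rw [modAbs, h2, Algebra.norm_apply]
    rfl

theorem modAbs_mul (x y : F) : modAbs (x * y) = modAbs x * modAbs y := by
  simp [modAbs, mul_pow]

theorem modAbs_pos {x : F} (hx : x ≠ 0) : 0 < modAbs x := by
  unfold modAbs; positivity

theorem modAbs_nonneg (x : F) : 0 ≤ modAbs x := by
  unfold modAbs; positivity

theorem modAbs_div (x y : F) : modAbs (x / y) = modAbs x / modAbs y := by
  simp [modAbs, div_pow]

theorem modAbs_prod {ι : Type*} (s : Finset ι) (f : ι → F) :
    modAbs (∏ i ∈ s, f i) = ∏ i ∈ s, modAbs (f i) := by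
  simp [modAbs, Finset.prod_pow]

/-- The space of strictly upper triangular matrices, in coordinates. -/
abbrev Nil (F : Type*) (m : ℕ) : Type _ := {p : Fin m × Fin m // p.1 < p.2} → F

/-- The strictly upper triangular matrix with the given coordinates. -/
def nilMat : Nil F m →ₗ[F] Matrix (Fin m) (Fin m) F where
  toFun X := Matrix.of fun i j => if h : i < j then X ⟨(i, j), h⟩ else 0
  map_add' X Y := by
    ext i j
    simp only [Matrix.of_apply, Matrix.add_apply, Pi.add_apply]
    split_ifs <;> simp
  map_smul' c X := by
    ext i j
    simp only [Matrix.of_apply, Matrix.smul_apply, Pi.smul_apply, RingHom.id_apply]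
    split_ifs <;> simp

theorem nilMat_apply (X : Nil F m) (i j : Fin m) :
    nilMat X i j = if h : i < j then X ⟨(i, j), h⟩ else 0 := rfl

/-- The coordinates of the strictly upper triangular part of a matrix. -/
def nilPart : Matrix (Fin m) (Fin m) F →ₗ[F] Nil F m where
  toFun A p := A p.1.1 p.1.2
  map_add' _ _ := rfl
  map_smul' _ _ := rfl

theorem nilPart_apply (A : Matrix (Fin m) (Fin m) F) (p : {p : Fin m × Fin m // p.1 < p.2}) :
    nilPart A p = A p.1.1 p.1.2 := rfl

theorem nilPart_nilMat (X : Nil F m) : nilPart (nilMat X) = X := by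
  funext p
  rw [nilPart_apply, nilMat_apply, dif_pos p.2]

/-- The upper triangular matrix with the given diagonal and strictly upper triangular part. -/
def triMat (t : Fin m → F) (X : Nil F m) : Matrix (Fin m) (Fin m) F :=
  Matrix.diagonal t + nilMat X

theorem triMat_of_lt (t : Fin m → F) (X : Nil F m) {i j : Fin m} (h : j < i) :
    triMat t X i j = 0 := by
  rw [triMat, Matrix.add_apply, nilMat_apply, dif_neg h.not_gt, Matrix.diagonal_apply_ne _ h.ne',
    add_zero]

theorem triMat_self (t : Fin m → F) (X : Nil F m) (i : Fin m) : triMat t X i i = t i := by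
  rw [triMat, Matrix.add_apply, nilMat_apply, dif_neg (lt_irrefl i), Matrix.diagonal_apply_eq,
    add_zero]

theorem triMat_of_gt (t : Fin m → F) (X : Nil F m) {i j : Fin m} (h : i < j) :
    triMat t X i j = X ⟨(i, j), h⟩ := by
  rw [triMat, Matrix.add_apply, nilMat_apply, dif_pos h, Matrix.diagonal_apply_ne _ h.ne,
    zero_add]

theorem blockTriangular_triMat (t : Fin m → F) (X : Nil F m) :
    (triMat t X).BlockTriangular id := fun _ _ h => triMat_of_lt t X h

theorem blockTriangular_nilMat (X : Nil F m) :
    (nilMat X).BlockTriangular id := fun i j h => by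
  exact dif_neg (not_lt_of_gt (show j < i from h))

theorem eq_triMat {A : Matrix (Fin m) (Fin m) F} (hA : A.BlockTriangular id) :
    A = triMat (fun i => A i i) (nilPart A) := by
  ext i j
  rcases lt_trichotomy i j with h | rfl | h
  · rw [triMat_of_gt _ _ h, nilPart_apply]
  · rw [triMat_self]
  · rw [triMat_of_lt _ _ h, hA h]

theorem det_of_blockTriangular {A : Matrix (Fin m) (Fin m) F} (hA : A.BlockTriangular id) :
    A.det = ∏ i, A i i := Matrix.det_of_isUpperTriangular hA

theorem det_triMat (t : Fin m → F) (X : Nil F m) : (triMat t X).det = ∏ i, t i := by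
  rw [det_of_blockTriangular (blockTriangular_triMat t X)]
  simp only [triMat_self]

/-- The invertible upper triangular matrices, in coordinates. -/
def borelMat (p : Torus F m × Nil F m) : GL (Fin m) F :=
  Matrix.GeneralLinearGroup.mkOfDetNeZero (triMat (fun i => (p.1 i : F)) p.2) (by
    rw [det_triMat]; exact Finset.prod_ne_zero_iff.2 fun i _ => (p.1 i).ne_zero)

theorem borelMat_val (p : Torus F m × Nil F m) :
    (borelMat p).val = triMat (fun i => (p.1 i : F)) p.2 := rfl

theorem exists_borelMat {g : GL (Fin m) F} (hg : g.val.BlockTriangular id) :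
    ∃ p, borelMat p = g := by
  have hdet : ∏ i, g.val i i ≠ 0 := by
    rw [← det_of_blockTriangular hg]
    exact (g.isUnit.map Matrix.detMonoidHom).ne_zero
  refine ⟨(fun i => Units.mk0 (g.val i i) (Finset.prod_ne_zero_iff.1 hdet i (Finset.mem_univ i)),
    nilPart g.val), Units.ext ?_⟩
  rw [borelMat_val]
  exact (eq_triMat hg).symm

theorem mul_diag_apply {A B : Matrix (Fin m) (Fin m) F} (hA : A.BlockTriangular id)
    (hB : B.BlockTriangular id) (i : Fin m) : (A * B) i i = A i i * B i i := by
  rw [Matrix.mul_apply]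
  refine Finset.sum_eq_single i (fun j _ hj => ?_) (by simp)
  rcases lt_or_gt_of_ne hj with h | h
  · rw [hA h, zero_mul]
  · rw [hB h, mul_zero]

open scoped ComplexOrder in
/-- The Iwasawa decomposition of `GL_m(F)`. -/
theorem exists_iwasawa (g : GL (Fin m) F) :
    ∃ (p : Torus F m × Nil F m) (k : maxCompact F m), g = borelMat p * k := by
  -- Gram–Schmidt on the columns of `g⁻¹`: the LDL decomposition of its Gram matrix gives an upper
  -- triangular `U` such that `M = g⁻¹ U` has orthogonal columns, and `e` rescales them to unit
  -- length. So `q = g⁻¹ b` with `b = U diag(e)` lies in `K`, and `g = b q⁻¹`.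
  set S : Matrix (Fin m) (Fin m) F := (g⁻¹).valᴴ * (g⁻¹).val with hS
  have hpos : S.PosDef := by
    refine Matrix.PosDef.conjTranspose_mul_self _ ?_
    exact Matrix.mulVec_injective_of_isUnit (g⁻¹).isUnit
  set U := (LDL.lowerInv hpos)ᴴ with hU
  have hUunit : IsUnit U := by
    rw [hU, ← Matrix.star_eq_conjTranspose]
    exact (isUnit_of_invertible (LDL.lowerInv hpos)).star
  set M := (g⁻¹).val * U with hM
  have hMM : Mᴴ * M = LDL.diag hpos := by
    rw [LDL.diag_eq_lowerInv_conj, hM, Matrix.conjTranspose_mul, hU,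
      Matrix.conjTranspose_conjTranspose]
    change _ = LDL.lowerInv hpos * ((g⁻¹).valᴴ * (g⁻¹).val) * _
    simp only [Matrix.mul_assoc]
  have hMunit : IsUnit M := (g⁻¹).isUnit.mul hUunit
  set d : Fin m → ℝ := fun j => ∑ i, ‖M i j‖ ^ 2 with hd
  have hdM : Mᴴ * M = Matrix.diagonal fun j => (d j : F) := by
    ext i j
    rcases eq_or_ne i j with rfl | hij
    · rw [Matrix.diagonal_apply_eq, Matrix.mul_apply, hd]
      push_cast
      refine Finset.sum_congr rfl fun k _ => ?_
      rw [Matrix.conjTranspose_apply, RCLike.star_def, RCLike.conj_mul]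
    · rw [hMM, LDL.diag, Matrix.diagonal_apply_ne _ hij, Matrix.diagonal_apply_ne _ hij]
  have hdpos : ∀ j, 0 < d j := by
    intro j
    refine lt_of_le_of_ne (Finset.sum_nonneg fun i _ => by positivity) fun h0 => ?_
    have hu : IsUnit (Mᴴ * M) := by
      rw [← Matrix.star_eq_conjTranspose]; exact hMunit.star.mul hMunit
    rw [hdM, Matrix.isUnit_iff_isUnit_det, Matrix.det_diagonal, isUnit_iff_ne_zero,
      Finset.prod_ne_zero_iff] at hu
    exact hu j (Finset.mem_univ j) (by rw [← h0]; simp)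
  set e : Fin m → F := fun j => ((Real.sqrt (d j))⁻¹ : ℝ) with he
  have he0 : ∀ j, e j ≠ 0 := fun j => by
    have := Real.sqrt_pos.2 (hdpos j)
    simp only [he]
    exact_mod_cast (inv_pos.2 this).ne'
  have hQ : (M * Matrix.diagonal e)ᴴ * (M * Matrix.diagonal e) = 1 := by
    rw [Matrix.conjTranspose_mul, Matrix.mul_assoc, ← Matrix.mul_assoc _ M, hdM,
      Matrix.diagonal_conjTranspose, Matrix.diagonal_mul_diagonal, Matrix.diagonal_mul_diagonal,
      ← Matrix.diagonal_one]
    congr 1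
    funext j
    have hs : (Real.sqrt (d j)) ≠ 0 := (Real.sqrt_pos.2 (hdpos j)).ne'
    have h2 : (Real.sqrt (d j))⁻¹ * (d j * (Real.sqrt (d j))⁻¹) = 1 := by
      nth_rewrite 2 [← Real.mul_self_sqrt (hdpos j).le]
      field_simp
    simp only [he, Pi.star_apply, RCLike.star_def, RCLike.conj_ofReal]
    exact_mod_cast h2
  have hE : IsUnit (Matrix.diagonal e) := by
    rw [Matrix.isUnit_iff_isUnit_det, Matrix.det_diagonal, isUnit_iff_ne_zero]
    exact Finset.prod_ne_zero_iff.2 fun i _ => he0 i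
  obtain ⟨q, hq⟩ : IsUnit (M * Matrix.diagonal e) := hMunit.mul hE
  obtain ⟨b, hb⟩ : IsUnit (U * Matrix.diagonal e) := hUunit.mul hE
  have hqb : q = g⁻¹ * b := Units.ext (by rw [Units.val_mul, hq, hb, hM, Matrix.mul_assoc])
  have hqK : q ∈ maxCompact F m := by
    change q.valᴴ * q.val = 1
    rw [hq, hQ]
  obtain ⟨p, hp⟩ := exists_borelMat (g := b) (by
    rw [hb]
    refine Matrix.BlockTriangular.mul (fun i j hij => ?_) (Matrix.blockTriangular_diagonal _)
    have h0 : LDL.lowerInv hpos j i = 0 := LDL.lowerInv_triangular hpos hij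
    exact (congrArg star h0).trans (star_zero F))
  refine ⟨p, ⟨q⁻¹, inv_mem hqK⟩, ?_⟩
  rw [hp]
  simp [hqb]

end

/-! ### Haar measure of the group of upper triangular matrices. -/

section

variable {F : Type*} [RCLike F] {m : ℕ}

theorem continuous_to_GL {X : Type*} [TopologicalSpace X] {f : X → GL (Fin m) F}
    (hf : Continuous fun x => (f x).val) : Continuous f := by
  refine Units.continuous_iff.2 ⟨hf, ?_⟩
  have h : (fun x => ((f x)⁻¹).val) = fun x => ((f x).val.det)⁻¹ • (f x).val.adjugate := by
    funext x
    rw [Matrix.coe_units_inv, Matrix.inv_def, Ring.inverse_eq_inv']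
  rw [h]
  exact (hf.matrix_det.inv₀ fun x =>
    ((f x).isUnit.map Matrix.detMonoidHom).ne_zero).smul hf.matrix_adjugate

theorem continuous_nilMat : Continuous (nilMat : Nil F m → Matrix (Fin m) (Fin m) F) := by
  refine continuous_matrix fun i j => ?_
  simp only [nilMat_apply]
  split_ifs with h
  · exact continuous_apply _
  · exact continuous_const

theorem continuous_borelMat : Continuous (borelMat : Torus F m × Nil F m → GL (Fin m) F) := by
  refine continuous_to_GL ?_
  simp only [borelMat_val, triMat]
  refine Continuous.add (Continuous.matrix_diagonal ?_) (continuous_nilMat.comp continuous_snd)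
  exact continuous_pi fun i => Units.continuous_val.comp ((continuous_apply i).comp continuous_fst)

/-- Left multiplication by an upper triangular matrix on strictly upper triangular matrices. -/
def leftLin (A : Matrix (Fin m) (Fin m) F) : Nil F m →ₗ[F] Nil F m :=
  nilPart ∘ₗ LinearMap.mulLeft F A ∘ₗ nilMat

/-- Right multiplication by an upper triangular matrix on strictly upper triangular matrices. -/
def rightLin (A : Matrix (Fin m) (Fin m) F) : Nil F m →ₗ[F] Nil F m :=
  nilPart ∘ₗ LinearMap.mulRight F A ∘ₗ nilMat

theorem triMat_mul_triMat_left (t₀ t : Fin m → F) (X₀ X : Nil F m) :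
    triMat t₀ X₀ * triMat t X = triMat (fun i => t₀ i * t i)
      (leftLin (triMat t₀ X₀) X + nilPart (triMat t₀ X₀ * Matrix.diagonal t)) := by
  have h := eq_triMat ((blockTriangular_triMat t₀ X₀).mul (blockTriangular_triMat t X))
  rw [h]
  congr 1
  · funext i
    rw [mul_diag_apply (blockTriangular_triMat t₀ X₀) (blockTriangular_triMat t X), triMat_self,
      triMat_self]
  · rw [triMat.eq_1 t X, mul_add, map_add, add_comm]
    rfl

theorem triMat_mul_triMat_right (t₀ t : Fin m → F) (X₀ X : Nil F m) :
    triMat t X * triMat t₀ X₀ = triMat (fun i => t i * t₀ i)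
      (rightLin (triMat t₀ X₀) X + nilPart (Matrix.diagonal t * triMat t₀ X₀)) := by
  have h := eq_triMat ((blockTriangular_triMat t X).mul (blockTriangular_triMat t₀ X₀))
  rw [h]
  congr 1
  · funext i
    rw [mul_diag_apply (blockTriangular_triMat t X) (blockTriangular_triMat t₀ X₀), triMat_self,
      triMat_self]
  · rw [triMat.eq_1 t X, add_mul, map_add, add_comm]
    rfl

/-- Left multiplication keeps each column of `X` separate and mixes rows through the upper
triangular `A`. Its matrix is thus block triangular for the row index, and the block of row `k` is
scalar, equal to `A k k`. -/
theorem det_leftLin {A : Matrix (Fin m) (Fin m) F} (hA : A.BlockTriangular id) :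
    LinearMap.det (leftLin A) =
      ∏ p : {p : Fin m × Fin m // p.1 < p.2}, A p.1.1 p.1.1 := by
  rw [← LinearMap.det_toMatrix']
  set M := LinearMap.toMatrix' (leftLin A) with hM
  have hMe : ∀ p q, M p q = if q.1.2 = p.1.2 then A p.1.1 q.1.1 else 0 := by
    intro p q
    rw [hM, LinearMap.toMatrix'_apply]
    change (A * nilMat (Pi.single q (1 : F)) : Matrix (Fin m) (Fin m) F) p.1.1 p.1.2 = _
    rw [Matrix.mul_apply, Finset.sum_eq_single q.1.1]
    · rw [nilMat_apply]
      split_ifs with h1 h2 h2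
      · have : (⟨(q.1.1, p.1.2), h1⟩ : {p : Fin m × Fin m // p.1 < p.2}) = q :=
          Subtype.ext (Prod.ext rfl h2.symm)
        rw [this, Pi.single_eq_same, mul_one]
      · rw [Pi.single_eq_of_ne, mul_zero]
        intro h
        exact h2 (congrArg (fun p => p.1.2) h).symm
      · exact absurd (h2 ▸ q.2) h1
      · rw [mul_zero]
    · intro k _ hk
      rw [nilMat_apply]
      split_ifs with h1
      · rw [Pi.single_eq_of_ne, mul_zero]
        intro h
        exact hk (congrArg (fun p => p.1.1) h)
      · rw [mul_zero]
    · simp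
  have htri : M.BlockTriangular fun p => p.1.1 := by
    intro p q hpq
    rw [hMe]
    split_ifs
    · exact hA hpq
    · rfl
  rw [htri.det_fintype, ← Fintype.prod_fiberwise (fun p : {p : Fin m × Fin m // p.1 < p.2} => p.1.1)]
  refine Finset.prod_congr rfl fun k _ => ?_
  have hd : M.toSquareBlock (fun p => p.1.1) k = Matrix.diagonal fun p => A p.1.1.1 p.1.1.1 := by
    ext p q
    rw [Matrix.toSquareBlock_def, Matrix.of_apply, hMe]
    rcases eq_or_ne p q with rfl | hpq
    · rw [Matrix.diagonal_apply_eq, if_pos rfl]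
    · rw [Matrix.diagonal_apply_ne _ hpq, if_neg]
      intro h
      exact hpq (Subtype.ext (Subtype.ext (Prod.ext (p.2.trans q.2.symm) h.symm)))
  rw [hd, Matrix.det_diagonal]

/-- The value of this determinant is irrelevant, so injectivity suffices: `nilMat X * b` is already
strictly upper triangular, hence `nilPart` loses nothing, and `b` is invertible. -/
theorem det_rightLin_ne_zero (b : GL (Fin m) F) (hb : b.val.BlockTriangular id) :
    LinearMap.det (rightLin b.val) ≠ 0 := by
  have hinj : Function.Injective (rightLin b.val) := by
    rw [← LinearMap.ker_eq_bot, LinearMap.ker_eq_bot']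
    intro X hX
    have h1 : nilMat X * b.val = 0 := by
      rw [eq_triMat ((blockTriangular_nilMat X).mul hb)]
      have h2 : nilPart (nilMat X * b.val) = 0 := hX
      have h3 : (fun i => (nilMat X * b.val) i i) = fun _ => 0 := by
        funext i
        rw [mul_diag_apply (blockTriangular_nilMat X) hb, nilMat_apply, dif_neg (lt_irrefl i),
          zero_mul]
      rw [h2, h3, triMat, map_zero, add_zero]
      exact Matrix.diagonal_zero
    have h4 : nilMat X = 0 := by
      have := congrArg (· * (b⁻¹).val) h1
      simpa only [Matrix.mul_assoc, Units.mul_inv, mul_one, zero_mul] using this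
    rw [← nilPart_nilMat X, h4, map_zero]
  have := (LinearEquiv.ofInjectiveEndo (rightLin b.val) hinj).isUnit_det'
  exact this.ne_zero

/-- The real Jacobian of an `F`-linear map is the norm of its determinant over `F`, whose absolute
value is `modAbs`. -/
theorem lintegral_linear_add {L : Nil F m →ₗ[F] Nil F m} (hL : LinearMap.det L ≠ 0) (a : Nil F m)
    {f : Nil F m → ENNReal} (hf : Measurable f) :
    ∫⁻ X, f (L X + a) = ENNReal.ofReal (modAbs (LinearMap.det L))⁻¹ * ∫⁻ X, f X := by
  have hdet : LinearMap.det (L.restrictScalars ℝ) = Algebra.norm ℝ (LinearMap.det L) :=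
    LinearMap.det_restrictScalars
  have hne : LinearMap.det (L.restrictScalars ℝ) ≠ 0 := by
    rw [hdet, ← abs_pos, abs_norm_eq_modAbs]
    exact modAbs_pos hL
  have h := Measure.map_linearMap_addHaar_eq_smul_addHaar (volume : Measure (Nil F m)) hne
  rw [hdet, abs_inv, abs_norm_eq_modAbs] at h
  have hmeas : Measurable (L.restrictScalars ℝ) :=
    (LinearMap.continuous_of_finiteDimensional (L.restrictScalars ℝ)).measurable
  calc ∫⁻ X, f (L X + a) = ∫⁻ Y, f (Y + a) ∂(Measure.map (L.restrictScalars ℝ) volume) := by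
        exact (lintegral_map (hf.comp (measurable_add_const a)) hmeas).symm
    _ = _ := by
        rw [h, lintegral_smul_measure, lintegral_add_right_eq_self, smul_eq_mul]

/-- The density of a left Haar measure of the group of upper triangular matrices. -/
def borelDensity (t : Torus F m) : ℝ :=
  ∏ p : {p : Fin m × Fin m // p.1 < p.2}, (modAbs (t p.1.1 : F))⁻¹

theorem borelDensity_mul (t t' : Torus F m) :
    borelDensity (t * t') = borelDensity t * borelDensity t' := by
  simp only [borelDensity, Pi.mul_apply, Units.val_mul, modAbs_mul, mul_inv,
    Finset.prod_mul_distrib]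

theorem borelDensity_pos (t : Torus F m) : 0 < borelDensity t :=
  Finset.prod_pos fun p _ => inv_pos.2 (modAbs_pos (t p.1.1).ne_zero)

theorem continuous_modAbs : Continuous (modAbs : F → ℝ) := by
  unfold modAbs; fun_prop

theorem continuous_borelDensity : Continuous (borelDensity : Torus F m → ℝ) := by
  refine continuous_finsetProd _ fun p _ => ?_
  refine Continuous.inv₀ (continuous_modAbs.comp (Units.continuous_val.comp (continuous_apply _)))
    fun t => (modAbs_pos (t p.1.1).ne_zero).ne'

/-- A left Haar measure of the group of upper triangular matrices, in coordinates. -/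
def borelMeasure (μT : Measure (Torus F m)) : Measure (Torus F m × Nil F m) :=
  (μT.withDensity fun t => ENNReal.ofReal (borelDensity t)).prod volume

variable (μT : Measure (Torus F m))

theorem measurable_ofReal_borelDensity :
    Measurable fun t : Torus F m => ENNReal.ofReal (borelDensity t) :=
  continuous_borelDensity.measurable.ennreal_ofReal

theorem lintegral_borelMeasure {f : Torus F m × Nil F m → ENNReal} (hf : Measurable f) :
    ∫⁻ p, f p ∂(borelMeasure μT) =
      ∫⁻ t, (ENNReal.ofReal (borelDensity t) * ∫⁻ X, f (t, X)) ∂μT := by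
  rw [borelMeasure, lintegral_prod _ hf.aemeasurable,
    lintegral_withDensity_eq_lintegral_mul _ measurable_ofReal_borelDensity
      hf.lintegral_prod_right']
  rfl

variable [μT.IsHaarMeasure]

instance instSFiniteBorelMeasure : SFinite (borelMeasure μT) := by
  have : SigmaFinite μT := inferInstance
  unfold borelMeasure
  infer_instance

/-- Left translation sends `(t, X)` to `t₀ t` and an affine image of `X`. The inverse Jacobian in
`X` is `borelDensity t₀`, exactly what turns the density at `t` into the density at `t₀ t`;
invariance of `μT` does the rest. -/
theorem lintegral_borelMeasure_mul_left (p₀ : Torus F m × Nil F m) {f : GL (Fin m) F → ENNReal}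
    (hf : Measurable f) :
    ∫⁻ p, f (borelMat p₀ * borelMat p) ∂(borelMeasure μT) =
      ∫⁻ p, f (borelMat p) ∂(borelMeasure μT) := by
  have hfb : Measurable fun p => f (borelMat p) := hf.comp continuous_borelMat.measurable
  have hfb' : Measurable fun p => f (borelMat p₀ * borelMat p) :=
    hf.comp (continuous_const.mul continuous_borelMat).measurable
  rw [lintegral_borelMeasure μT hfb, lintegral_borelMeasure μT hfb']
  set A := triMat (fun i => (p₀.1 i : F)) p₀.2
  have hA : LinearMap.det (leftLin A) = ∏ p : {p : Fin m × Fin m // p.1 < p.2}, (p₀.1 p.1.1 : F) := by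
    rw [det_leftLin (blockTriangular_triMat _ _)]
    simp only [triMat_self]
  have hA0 : LinearMap.det (leftLin A) ≠ 0 := by
    rw [hA]; exact Finset.prod_ne_zero_iff.2 fun p _ => (p₀.1 p.1.1).ne_zero
  have hmod : (modAbs (LinearMap.det (leftLin A)))⁻¹ = borelDensity p₀.1 := by
    rw [hA, modAbs_prod, borelDensity, Finset.prod_inv_distrib]
  have key : ∀ t : Torus F m, ENNReal.ofReal (borelDensity t) *
      ∫⁻ X, f (borelMat p₀ * borelMat (t, X)) = ENNReal.ofReal (borelDensity (p₀.1 * t)) *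
      ∫⁻ X, f (borelMat (p₀.1 * t, X)) := by
    intro t
    have e : ∀ X, borelMat p₀ * borelMat (t, X) = borelMat (p₀.1 * t,
        leftLin A X + nilPart (A * Matrix.diagonal fun i => (t i : F))) := fun X =>
      Units.ext (by
        rw [Units.val_mul, borelMat_val, borelMat_val, borelMat_val]
        exact triMat_mul_triMat_left _ _ _ _)
    simp only [e]
    rw [lintegral_linear_add hA0 _ (f := fun X => f (borelMat (p₀.1 * t, X)))
      (hfb.comp measurable_prodMk_left), hmod, borelDensity_mul, ENNReal.ofReal_mul
      (borelDensity_pos _).le, ← mul_assoc, mul_comm (ENNReal.ofReal (borelDensity t))]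
  simp only [key]
  exact lintegral_mul_left_eq_self (μ := μT)
    (fun t => ENNReal.ofReal (borelDensity t) * ∫⁻ X, f (borelMat (t, X))) p₀.1

/-- Only the existence of a modular factor matters: it enters the uniqueness argument for `μG`
inside an integral that is evaluated indirectly. -/
theorem exists_lintegral_borelMeasure_mul_right (p₀ : Torus F m × Nil F m) :
    ∃ c : ENNReal, ∀ f : GL (Fin m) F → ENNReal, Measurable f →
      ∫⁻ p, f (borelMat p * borelMat p₀) ∂(borelMeasure μT) =
        c * ∫⁻ p, f (borelMat p) ∂(borelMeasure μT) := by
  set A := triMat (fun i => (p₀.1 i : F)) p₀.2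
  have hA0 : LinearMap.det (rightLin A) ≠ 0 :=
    det_rightLin_ne_zero (borelMat p₀) (blockTriangular_triMat _ _)
  refine ⟨ENNReal.ofReal (borelDensity p₀.1)⁻¹ *
    ENNReal.ofReal (modAbs (LinearMap.det (rightLin A)))⁻¹, fun f hf => ?_⟩
  have hfb : Measurable fun p => f (borelMat p) := hf.comp continuous_borelMat.measurable
  have hfb' : Measurable fun p => f (borelMat p * borelMat p₀) :=
    hf.comp (continuous_borelMat.mul continuous_const).measurable
  rw [lintegral_borelMeasure μT hfb, lintegral_borelMeasure μT hfb']
  set c₁ := ENNReal.ofReal (borelDensity p₀.1)⁻¹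
  set c₂ := ENNReal.ofReal (modAbs (LinearMap.det (rightLin A)))⁻¹
  have key : ∀ t : Torus F m, ENNReal.ofReal (borelDensity t) *
      ∫⁻ X, f (borelMat (t, X) * borelMat p₀) = c₁ * c₂ *
        (ENNReal.ofReal (borelDensity (t * p₀.1)) * ∫⁻ X, f (borelMat (t * p₀.1, X))) := by
    intro t
    have e : ∀ X, borelMat (t, X) * borelMat p₀ = borelMat (t * p₀.1,
        rightLin A X + nilPart ((Matrix.diagonal fun i => (t i : F)) * A)) := fun X =>
      Units.ext (by
        rw [Units.val_mul, borelMat_val, borelMat_val, borelMat_val]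
        exact triMat_mul_triMat_right _ _ _ _)
    have hd : ENNReal.ofReal (borelDensity t) =
        c₁ * ENNReal.ofReal (borelDensity (t * p₀.1)) := by
      rw [← ENNReal.ofReal_mul (inv_pos.2 (borelDensity_pos _)).le, borelDensity_mul]
      congr 1
      field_simp [(borelDensity_pos p₀.1).ne']
    simp only [e]
    rw [lintegral_linear_add hA0 _ (f := fun X => f (borelMat (t * p₀.1, X)))
      (hfb.comp measurable_prodMk_left), hd]
    ring
  simp only [key]
  have hm : Measurable fun t : Torus F m =>
      ENNReal.ofReal (borelDensity t) * ∫⁻ X, f (borelMat (t, X)) :=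
    measurable_ofReal_borelDensity.mul hfb.lintegral_prod_right'
  refine (lintegral_const_mul _ (hm.comp (measurable_mul_const p₀.1))).trans ?_
  congr 1
  exact lintegral_mul_right_eq_self (μ := μT)
    (fun t => ENNReal.ofReal (borelDensity t) * ∫⁻ X, f (borelMat (t, X))) p₀.1

end

/-! ### Haar measure of `GL_m(F)` in Iwasawa coordinates. -/

section

variable {F : Type*} [RCLike F] {m : ℕ}

theorem isCompact_units_bounded (R : ℝ) :
    IsCompact {x : Fˣ | ‖(x : F)‖ ≤ R ∧ ‖((x⁻¹ : Fˣ) : F)‖ ≤ R} := by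
  have hB : IsCompact (Metric.closedBall (0 : F) R) := ProperSpace.isCompact_closedBall _ _
  have h2 := hB.prod (MulOpposite.opHomeomorph.symm.isClosedEmbedding.isCompact_preimage hB)
  have h3 := (Units.isClosedEmbedding_embedProduct (α := F)).isCompact_preimage h2
  convert h3 using 1
  ext x
  simp

/-- The diagonal of the inverse of a triangular matrix consists of the inverses of the diagonal
entries, so the two norm bounds confine each `t_i` to a compact subset of `Fˣ`. -/
theorem borelMat_preimage_biBall_subset :
    borelMat ⁻¹' biBall F m ⊆
      (Set.univ.pi fun _ : Fin m =>
        {x : Fˣ | ‖(x : F)‖ ≤ m + 1 ∧ ‖((x⁻¹ : Fˣ) : F)‖ ≤ m + 1}) ×ˢ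
      Metric.closedBall (0 : Nil F m) (m + 1) := by
  have h0 : (0 : ℝ) ≤ m + 1 := by positivity
  rintro p ⟨h1, h2⟩
  have hb : ∀ i j, ‖(borelMat p).val i j‖ ≤ m + 1 := fun i j =>
    (Matrix.norm_entry_le_entrywise_sup_norm _).trans (norm_le_of_hsNormSq_le h0 h1)
  have hb' : ∀ i j, ‖((borelMat p)⁻¹).val i j‖ ≤ m + 1 := fun i j =>
    (Matrix.norm_entry_le_entrywise_sup_norm _).trans (norm_le_of_hsNormSq_le h0 h2)
  have htri : (borelMat p).val.BlockTriangular id := blockTriangular_triMat _ _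
  have htri' : ((borelMat p)⁻¹).val.BlockTriangular id := by
    rw [Matrix.coe_units_inv]
    have : Invertible (borelMat p).val := (borelMat p).invertible
    exact Matrix.blockTriangular_inv_of_blockTriangular htri
  refine ⟨fun i _ => ⟨?_, ?_⟩, ?_⟩
  · have := hb i i
    rwa [borelMat_val, triMat_self] at this
  · have h3 : ((borelMat p)⁻¹).val i i * (p.1 i : F) = 1 := by
      have h4 := mul_diag_apply htri' htri i
      rw [Units.inv_mul, Matrix.one_apply_eq, borelMat_val, triMat_self] at h4
      exact h4.symm
    have h5 : (((p.1 i)⁻¹ : Fˣ) : F) = ((borelMat p)⁻¹).val i i := by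
      rw [Units.val_inv_eq_inv_val]
      exact (eq_inv_of_mul_eq_one_left h3).symm
    rw [h5]
    exact hb' i i
  · rw [mem_closedBall_zero_iff, pi_norm_le_iff_of_nonneg h0]
    intro q
    have := hb q.1.1 q.1.2
    rwa [borelMat_val, triMat_of_gt _ _ q.2] at this

variable (μT : Measure (Torus F m)) [μT.IsHaarMeasure]

theorem borelMeasure_biBall_ne_top : borelMeasure μT (borelMat ⁻¹' biBall F m) ≠ ⊤ := by
  refine ne_top_of_le_ne_top ?_ (measure_mono borelMat_preimage_biBall_subset)
  have : IsLocallyFiniteMeasure (μT.withDensity fun t => ENNReal.ofReal (borelDensity t)) :=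
    IsLocallyFiniteMeasure.withDensity_ofReal continuous_borelDensity
  rw [borelMeasure, Measure.prod_prod]
  exact ENNReal.mul_ne_top
    (isCompact_univ_pi fun _ => isCompact_units_bounded _).measure_lt_top.ne
    (ProperSpace.isCompact_closedBall _ _).measure_lt_top.ne

theorem borelMeasure_biBall_ne_zero : borelMeasure μT (borelMat ⁻¹' biBall F m) ≠ 0 := by
  have : (μT.withDensity fun t => ENNReal.ofReal (borelDensity t)).IsOpenPosMeasure :=
    (withDensity_absolutelyContinuous' measurable_ofReal_borelDensity.aemeasurable
      (Filter.Eventually.of_forall fun t =>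
        (ENNReal.ofReal_pos.2 (borelDensity_pos t)).ne')).isOpenPosMeasure
  have h1 : borelMat ((1, 0) : Torus F m × Nil F m) = 1 := by
    refine Units.ext ?_
    rw [borelMat_val, triMat, map_zero, add_zero]
    simp
  have h2 : borelMat ⁻¹' biBall F m ∈ nhds ((1, 0) : Torus F m × Nil F m) :=
    continuous_borelMat.continuousAt.preimage_mem_nhds (by rw [h1]; exact biBall_mem_nhds)
  have : SigmaFinite μT := inferInstance
  have : (volume : Measure (Nil F m)).IsOpenPosMeasure := inferInstance
  have : (borelMeasure μT).IsOpenPosMeasure := Measure.prod.instIsOpenPosMeasure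
  exact (Measure.measure_pos_of_mem_nhds _ h2).ne'

variable (μK : Measure (maxCompact F m)) [μK.IsHaarMeasure]
  (μG : Measure (GL (Fin m) F)) [μG.IsHaarMeasure]

/-- The multiplication map of the Iwasawa decomposition. -/
def iwasawa (x : maxCompact F m × (Torus F m × Nil F m)) : GL (Fin m) F :=
  borelMat x.2 * x.1

theorem continuous_iwasawa :
    Continuous (iwasawa : maxCompact F m × (Torus F m × Nil F m) → GL (Fin m) F) :=
  (continuous_borelMat.comp continuous_snd).mul (continuous_subtype_val.comp continuous_fst)

set_option maxHeartbeats 400000 in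
/-- A Haar measure of `GL_m(F)` in the coordinates of the Iwasawa decomposition. -/
theorem exists_haar_eq_iwasawa : ∃ c : NNReal,
    μG = c • (μK.prod (borelMeasure μT)).map iwasawa := by
  set S := biBall F m
  have hSm : MeasurableSet S := isClosed_biBall.measurableSet
  set a : GL (Fin m) F → ENNReal := S.indicator 1 with ha
  have ham : Measurable a := measurable_one.indicator hSm
  have hak : ∀ (g : GL (Fin m) F) (k : maxCompact F m), a (g * k) = a g := fun g k => by
    by_cases hg : g ∈ S
    · rw [ha, Set.indicator_of_mem hg, Set.indicator_of_mem ((mul_mem_biBall k).2 hg)]; rfl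
    · rw [ha, Set.indicator_of_notMem hg,
        Set.indicator_of_notMem fun h => hg ((mul_mem_biBall k).1 h)]
  have hainv : ∀ g : GL (Fin m) F, a g⁻¹ = a g := fun g => by
    by_cases hg : g ∈ S
    · rw [ha, Set.indicator_of_mem hg, Set.indicator_of_mem (inv_mem_biBall.2 hg)]; rfl
    · rw [ha, Set.indicator_of_notMem hg, Set.indicator_of_notMem fun h => hg (inv_mem_biBall.1 h)]
  set μP := borelMeasure μT with hμP
  set j : ENNReal := ∫⁻ p, a (borelMat p) ∂μP with hj
  have hjS : j = μP (borelMat ⁻¹' S) := by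
    rw [hj, ← lintegral_indicator_one (continuous_borelMat.measurable hSm)]
    rfl
  set C : ENNReal := j * μK Set.univ with hC
  have hC0 : C ≠ 0 := mul_ne_zero (hjS ▸ borelMeasure_biBall_ne_zero μT)
    (NeZero.ne (μK Set.univ))
  have hCt : C ≠ ⊤ := ENNReal.mul_ne_top (hjS ▸ borelMeasure_biBall_ne_top μT)
    (measure_ne_top _ _)
  -- The functional `ν` is the candidate Haar integral. It is compared with `μG` as in the classical
  -- uniqueness proof, with the indicator `a` of `biBall` as test function.
  set ν : (GL (Fin m) F → ENNReal) → ENNReal := fun f =>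
    ∫⁻ k : maxCompact F m, ∫⁻ p, f (borelMat p * k) ∂μP ∂μK with hν
  have hνa : ν a = C := by
    simp only [hν, hak]
    rw [lintegral_const]
  -- right translates
  have hright : ∀ g : GL (Fin m) F, ∃ c : ENNReal, ∀ f : GL (Fin m) F → ENNReal, Measurable f →
      (∫⁻ k : maxCompact F m, ∫⁻ p, f (borelMat p * g * k) ∂μP ∂μK) = c * ν f := by
    intro g
    obtain ⟨p₀, k₀, rfl⟩ := exists_iwasawa g
    obtain ⟨c, hc⟩ := exists_lintegral_borelMeasure_mul_right μT p₀
    refine ⟨c, fun f hf => ?_⟩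
    have h1 : ∀ k : maxCompact F m,
        ∫⁻ p, f (borelMat p * (borelMat p₀ * k₀) * k) ∂μP =
          c * ∫⁻ p, f (borelMat p * ((k₀ * k : maxCompact F m) : GL (Fin m) F)) ∂μP := by
      intro k
      rw [← hc (fun g => f (g * ((k₀ * k : maxCompact F m) : GL (Fin m) F)))
        (hf.comp (continuous_mul_const _).measurable)]
      simp only [mul_assoc, Subgroup.coe_mul]
      rfl
    have hm : Measurable fun k : maxCompact F m =>
        ∫⁻ p, f (borelMat p * (k : GL (Fin m) F)) ∂μP :=
      (hf.comp continuous_iwasawa.measurable).lintegral_prod_right'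
    simp only [h1]
    refine (lintegral_const_mul _ (hm.comp (measurable_const_mul k₀))).trans ?_
    congr 1
    exact lintegral_mul_left_eq_self (μ := μK) (fun k : maxCompact F m =>
      ∫⁻ p, f (borelMat p * (k : GL (Fin m) F)) ∂μP) k₀
  choose D hD using hright
  -- Testing on `a` recovers the chosen factors `D g` as a parametric integral, which is measurable.
  have hDm : Measurable D := by
    have h1 : D = fun g =>
        (∫⁻ k : maxCompact F m, ∫⁻ p, a (borelMat p * g * k) ∂μP ∂μK) / C := by
      funext g
      rw [hD g a ham, hνa, ENNReal.mul_div_cancel_right hC0 hCt]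
    rw [h1]
    simp only [hak, lintegral_const]
    refine Measurable.div_const (Measurable.mul_const ?_ _) _
    exact (ham.comp ((continuous_borelMat.comp continuous_snd).mul
      continuous_fst).measurable).lintegral_prod_right'
  -- Expand `C` as the integral of `a (b⁻¹ g)` over `b` and `k`, exchange the integrals, substitute
  -- `b g k` for `g`, and exchange back. The inner integral of `f (b g k)` is then `D g * ν f`.
  have key : ∀ f : GL (Fin m) F → ENNReal, Measurable f →
      C * ∫⁻ g, f g ∂μG = (∫⁻ g, a g * D g ∂μG) * ν f := by
    intro f hf
    have hswap : ∀ H : GL (Fin m) F → maxCompact F m → Torus F m × Nil F m → ENNReal,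
        Measurable (fun x : GL (Fin m) F × (maxCompact F m × (Torus F m × Nil F m)) =>
          H x.1 x.2.1 x.2.2) →
        ∫⁻ g, ∫⁻ k, ∫⁻ p, H g k p ∂μP ∂μK ∂μG = ∫⁻ k, ∫⁻ p, ∫⁻ g, H g k p ∂μG ∂μP ∂μK := by
      intro H hH
      rw [lintegral_lintegral_swap]
      · refine lintegral_congr fun k => ?_
        rw [lintegral_lintegral_swap]
        exact (hH.comp (measurable_fst.prodMk
          (measurable_const.prodMk measurable_snd))).aemeasurable
      · refine Measurable.aemeasurable (Measurable.lintegral_prod_right' (ν := μP)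
          (f := fun x : (GL (Fin m) F × maxCompact F m) × (Torus F m × Nil F m) =>
            H x.1.1 x.1.2 x.2) ?_)
        exact hH.comp (measurable_fst.fst.prodMk (measurable_fst.snd.prodMk measurable_snd))
    have hval : Measurable fun x : GL (Fin m) F × (maxCompact F m × (Torus F m × Nil F m)) =>
        borelMat x.2.2 * x.1 * x.2.1 :=
      (((continuous_borelMat.comp continuous_snd.snd).mul continuous_fst).mul
        (continuous_subtype_val.comp continuous_snd.fst)).measurable
    have hval' : Measurable fun x : GL (Fin m) F × (maxCompact F m × (Torus F m × Nil F m)) =>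
        (borelMat x.2.2)⁻¹ * x.1 :=
      ((continuous_borelMat.comp continuous_snd.snd).inv.mul continuous_fst).measurable
    have h1 : ∀ (k : maxCompact F m) (p : Torus F m × Nil F m),
        ∫⁻ g, a g * f (borelMat p * g * k) ∂μG =
          ∫⁻ g, a ((borelMat p)⁻¹ * g) * f g ∂μG := by
      intro k p
      have hm : Measurable fun g => a ((borelMat p)⁻¹ * g) * f g :=
        (ham.comp (measurable_const_mul _)).mul hf
      conv_rhs => rw [← map_mul_right_maxCompact μG k,
        lintegral_map hm (continuous_mul_const _).measurable,
        ← lintegral_mul_left_eq_self (μ := μG) _ (borelMat p)]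
      refine lintegral_congr fun g => ?_
      rw [mul_assoc, inv_mul_cancel_left, hak]
    -- With `g = b₀ k₀`, invariance of `a` under `K` and inversion gives `a (b⁻¹ g) = a (b₀⁻¹ b)`,
    -- and left invariance removes `b₀⁻¹`.
    have h2 : ∀ g : GL (Fin m) F, ∫⁻ p, a ((borelMat p)⁻¹ * g) ∂μP = j := by
      intro g
      obtain ⟨p₀, k₀, rfl⟩ := exists_iwasawa g
      obtain ⟨p₁, hp₁⟩ : ∃ p₁ : Torus F m × Nil F m, borelMat p₁ = (borelMat p₀)⁻¹ := by
        refine exists_borelMat ?_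
        rw [Matrix.coe_units_inv]
        have : Invertible (borelMat p₀).val := (borelMat p₀).invertible
        exact Matrix.blockTriangular_inv_of_blockTriangular (blockTriangular_triMat _ _)
      rw [hj, ← lintegral_borelMeasure_mul_left μT p₁ ham]
      refine lintegral_congr fun p => ?_
      rw [← mul_assoc, hak, ← hainv, mul_inv_rev, inv_inv, hp₁]
    have h3 : ∀ g : GL (Fin m) F,
        ∫⁻ k : maxCompact F m, ∫⁻ p, a g * f (borelMat p * g * k) ∂μP ∂μK = a g * D g * ν f := by
      intro g
      have hm1 : Measurable fun x : maxCompact F m × (Torus F m × Nil F m) =>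
          f (borelMat x.2 * g * (x.1 : GL (Fin m) F)) :=
        hf.comp (((continuous_borelMat.comp continuous_snd).mul continuous_const).mul
          (continuous_subtype_val.comp continuous_fst)).measurable
      have hm2 : Measurable fun k : maxCompact F m => ∫⁻ p, f (borelMat p * g * (k : GL (Fin m) F)) ∂μP :=
        Measurable.lintegral_prod_right' (ν := μP) hm1
      have hm3 : ∀ k : maxCompact F m, Measurable fun p =>
          f (borelMat p * g * (k : GL (Fin m) F)) := fun k =>
        hf.comp ((continuous_borelMat.mul continuous_const).mul continuous_const).measurable
      rw [mul_assoc, ← hD g f hf, ← lintegral_const_mul _ hm2]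
      exact lintegral_congr fun k => lintegral_const_mul _ (hm3 k)
    calc C * ∫⁻ g, f g ∂μG
        = ∫⁻ g, ∫⁻ k, ∫⁻ p, a ((borelMat p)⁻¹ * g) * f g ∂μP ∂μK ∂μG := by
          rw [← lintegral_const_mul _ hf]
          refine lintegral_congr fun g => ?_
          rw [lintegral_const, lintegral_mul_const, h2]
          · rw [hC]; ring
          · exact ham.comp (continuous_borelMat.inv.mul continuous_const).measurable
      _ = ∫⁻ k, ∫⁻ p, ∫⁻ g, a ((borelMat p)⁻¹ * g) * f g ∂μG ∂μP ∂μK :=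
          hswap (fun g _ p => a ((borelMat p)⁻¹ * g) * f g)
            ((ham.comp hval').mul (hf.comp measurable_fst))
      _ = ∫⁻ k : maxCompact F m, ∫⁻ p, ∫⁻ g, a g * f (borelMat p * g * k) ∂μG ∂μP ∂μK := by
          simp only [h1]
      _ = ∫⁻ g, ∫⁻ k : maxCompact F m, ∫⁻ p, a g * f (borelMat p * g * k) ∂μP ∂μK ∂μG :=
          (hswap (fun g k p => a g * f (borelMat p * g * k))
            ((ham.comp measurable_fst).mul (hf.comp hval))).symm
      _ = ∫⁻ g, a g * D g * ν f ∂μG := by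
          simp only [h3]
      _ = (∫⁻ g, a g * D g ∂μG) * ν f := lintegral_mul_const _ (ham.mul hDm)
  -- Taking `f = a` in `key` evaluates the unknown constant.
  have hE : ∫⁻ g, a g * D g ∂μG = μG S := by
    have h1 := key a ham
    rw [hνa, mul_comm, ha, lintegral_indicator_one hSm] at h1
    exact ((ENNReal.mul_left_inj hC0 hCt).1 h1).symm
  have hfin : μG S / C ≠ ⊤ := ENNReal.div_ne_top isCompact_biBall.measure_lt_top.ne hC0
  refine ⟨(μG S / C).toNNReal, Measure.ext fun s hs => ?_⟩
  have h1 := key (s.indicator 1) (measurable_one.indicator hs)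
  rw [hE, lintegral_indicator_one hs] at h1
  have h2 : ν (s.indicator 1) = (μK.prod μP).map iwasawa s := by
    rw [← lintegral_indicator_one hs, lintegral_map (measurable_one.indicator hs)
      continuous_iwasawa.measurable, lintegral_prod]
    · rfl
    · exact ((measurable_one.indicator hs).comp continuous_iwasawa.measurable).aemeasurable
  rw [Measure.smul_apply, ENNReal.smul_def, ENNReal.coe_toNNReal hfin, smul_eq_mul, ← h2,
    ENNReal.div_eq_inv_mul, mul_assoc, ← h1, ← mul_assoc, ENNReal.inv_mul_cancel hC0 hCt, one_mul]

end

/-! ### Schwartz functions defined by parametric integrals. -/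

section ParametricSchwartz

variable {E E' : Type*} [NormedAddCommGroup E] [NormedSpace ℝ E]
  [NormedAddCommGroup E'] [NormedSpace ℝ E']

/-- The integral of a family of smooth functions with integrable Schwartz bounds is a Schwartz
function. -/
theorem exists_schwartzMap_eq_integral {Ω : Type*} [MeasurableSpace Ω] {μ : Measure Ω}
    {H : Ω → E → ℂ} (hsm : ∀ w, ContDiff ℝ ∞ (H w))
    (hmeas : ∀ n x, AEStronglyMeasurable (fun w => iteratedFDeriv ℝ n (H w) x) μ)
    (hb : ∀ k n : ℕ, ∃ B : Ω → ℝ, Integrable B μ ∧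
      ∀ w x, ‖x‖ ^ k * ‖iteratedFDeriv ℝ n (H w) x‖ ≤ B w) :
    ∃ φ : 𝓢(E, ℂ), ∀ x, φ x = ∫ w, H w x ∂μ := by
  have hint : ∀ n x, Integrable (fun w => iteratedFDeriv ℝ n (H w) x) μ := by
    intro n x
    obtain ⟨B, hB, hle⟩ := hb 0 n
    exact hB.mono' (hmeas n x) (Filter.Eventually.of_forall fun w => by simpa using hle w x)
  set p : E → FormalMultilinearSeries ℝ E ℂ := fun x n => ∫ w, iteratedFDeriv ℝ n (H w) x ∂μ
    with hp
  -- Differentiation under the integral sign, dominated by the bounds with `k = 0`; the bounds with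
  -- general `k` then give the decay.
  have hT : HasFTaylorSeriesUpTo ∞ (fun x => ∫ w, H w x ∂μ) p := by
    rw [hasFTaylorSeriesUpTo_top_iff' le_rfl]
    refine ⟨fun x => ?_, fun n x => ?_⟩
    · exact ((continuousMultilinearCurryFin0 ℝ E ℂ).toContinuousLinearEquiv.integral_comp_comm
        fun w => iteratedFDeriv ℝ 0 (H w) x).symm
    · obtain ⟨B, hB, hle⟩ := hb 0 (n + 1)
      set e := (continuousMultilinearCurryLeftEquiv ℝ (fun _ : Fin (n + 1) => E) ℂ).toLinearIsometry
      have hcurry : (p x n.succ).curryLeft =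
          ∫ w, (iteratedFDeriv ℝ (n + 1) (H w) x).curryLeft ∂μ := by
        have h := LinearIsometry.integral_comp_comm (𝕜 := ℝ) (E := E [×(n + 1)]→L[ℝ] ℂ)
          (F := E →L[ℝ] (E [×n]→L[ℝ] ℂ)) (μ := μ) e (fun w => iteratedFDeriv ℝ (n + 1) (H w) x)
        exact h.symm
      rw [hcurry]
      refine hasFDerivAt_integral_of_dominated_of_fderiv_le (s := Set.univ) (bound := B)
        (F := fun x w => iteratedFDeriv ℝ n (H w) x)
        (F' := fun x w => (iteratedFDeriv ℝ (n + 1) (H w) x).curryLeft)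
        Filter.univ_mem (Filter.Eventually.of_forall fun y => hmeas n y) (hint n x) ?_ ?_ hB ?_
      · exact e.continuous.comp_aestronglyMeasurable (hmeas (n + 1) x)
      · refine Filter.Eventually.of_forall fun w y _ => ?_
        rw [ContinuousMultilinearMap.curryLeft_norm]
        simpa using hle w y
      · refine Filter.Eventually.of_forall fun w y _ => ?_
        exact (contDiff_iff_ftaylorSeries.1 (hsm w)).fderiv n
          (by exact_mod_cast ENat.natCast_lt_top n) y
  refine ⟨⟨fun x => ∫ w, H w x ∂μ, hT.contDiff, fun k n => ?_⟩, fun x => rfl⟩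
  obtain ⟨B, hB, hle⟩ := hb k n
  refine ⟨∫ w, B w ∂μ, fun x => ?_⟩
  rw [← hT.eq_iteratedFDeriv (by exact_mod_cast le_top) x]
  calc ‖x‖ ^ k * ‖p x n‖ ≤ ‖x‖ ^ k * ∫ w, ‖iteratedFDeriv ℝ n (H w) x‖ ∂μ := by
        gcongr
        exact norm_integral_le_integral_norm _
    _ = ∫ w, ‖x‖ ^ k * ‖iteratedFDeriv ℝ n (H w) x‖ ∂μ := (integral_const_mul _ _).symm
    _ ≤ ∫ w, B w ∂μ := integral_mono ((hint n x).norm.const_mul _) hB fun w => hle w x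

theorem iteratedFDeriv_schwartz_affine (Φ : 𝓢(E', ℂ)) (L : E →L[ℝ] E') (y : E') (c : ℂ) (n : ℕ)
    (x : E) : iteratedFDeriv ℝ n (fun x => c * Φ (L x + y)) x =
      c • (iteratedFDeriv ℝ n Φ (L x + y)).compContinuousLinearMap fun _ => L := by
  have h1 : ContDiff ℝ ∞ fun z => Φ (z + y) :=
    (Φ.smooth ⊤).comp (contDiff_id.add contDiff_const)
  have h2 : ContDiff ℝ ∞ ((fun z => Φ (z + y)) ∘ L) := h1.comp L.contDiff
  have h3 : (fun x => c * Φ (L x + y)) = c • ((fun z => Φ (z + y)) ∘ L) := by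
    funext x; simp
  have hn : (n : ℕ∞ω) ≤ ∞ := by exact_mod_cast le_top
  rw [h3, iteratedFDeriv_const_smul_apply (h2.of_le hn).contDiffAt,
    L.iteratedFDeriv_comp_right h1 x hn, iteratedFDeriv_comp_add_right]

theorem contDiff_schwartz_affine (Φ : 𝓢(E', ℂ)) (L : E →L[ℝ] E') (y : E') (c : ℂ) :
    ContDiff ℝ ∞ fun x => c * Φ (L x + y) :=
  contDiff_const.mul ((Φ.smooth ⊤).comp (L.contDiff.add contDiff_const))

theorem continuous_iteratedFDeriv_schwartz_affine {Ω : Type*} [TopologicalSpace Ω]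
    (Φ : 𝓢(E', ℂ)) {L : Ω → E →L[ℝ] E'} {y : Ω → E'} {c : Ω → ℂ} (hL : Continuous L)
    (hy : Continuous y) (hc : Continuous c) (n : ℕ) (x : E) :
    Continuous fun w => iteratedFDeriv ℝ n (fun x => c w * Φ (L w x + y w)) x := by
  simp only [iteratedFDeriv_schwartz_affine]
  refine hc.smul ?_
  have h1 : Continuous fun w => iteratedFDeriv ℝ n Φ (L w x + y w) :=
    ((Φ.smooth ⊤).continuous_iteratedFDeriv (by exact_mod_cast le_top)).comp
      ((hL.clm_apply continuous_const).add hy)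
  have h2 : Continuous fun w =>
      ContinuousMultilinearMap.compContinuousLinearMapContinuousMultilinear ℝ
        (fun _ : Fin n => E) (fun _ : Fin n => E') ℂ (fun _ => L w) :=
    (ContinuousMultilinearMap.cont _).comp (continuous_pi fun _ => hL)
  exact h2.clm_apply h1

/-- The constant is uniform in `L`, `y`, `c`. Decay of order `N + N` of `Φ` is split into order `N`
in `x` and order `N` in an auxiliary size `q`, later the norm of the unipotent parameter; both are
controlled by the argument of `Φ`. -/
theorem exists_schwartz_affine_bound (Φ : 𝓢(E', ℂ)) {A Λ Γ : ℝ} (hA : 1 ≤ A) (hΛ : 0 ≤ Λ)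
    (hΓ : 0 ≤ Γ) (n N : ℕ) :
    ∃ C : ℝ, ∀ (L : E →L[ℝ] E') (y : E') (c : ℂ) (x : E) (q : ℝ), ‖L‖ ≤ Λ → ‖c‖ ≤ Γ → 0 ≤ q →
      ‖x‖ ≤ A * ‖L x + y‖ → q ≤ A * ‖L x + y‖ →
      (1 + ‖x‖) ^ N * (1 + q) ^ N * ‖iteratedFDeriv ℝ n (fun x => c * Φ (L x + y)) x‖ ≤ C := by
  set D := 2 ^ (N + N) * (Finset.Iic (N + N, n)).sup (fun m => SchwartzMap.seminorm ℝ m.1 m.2) Φ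
  refine ⟨A ^ (N + N) * (Γ * (Λ ^ n * D)), fun L y c x q hL hc hq hx hqx => ?_⟩
  have hD := SchwartzMap.one_add_le_sup_seminorm_apply (𝕜 := ℝ) (m := (N + N, n)) le_rfl le_rfl Φ
    (L x + y)
  have h1 : 1 + ‖x‖ ≤ A * (1 + ‖L x + y‖) := by linarith
  have h2 : 1 + q ≤ A * (1 + ‖L x + y‖) := by linarith
  have h3 : ‖(iteratedFDeriv ℝ n Φ (L x + y)).compContinuousLinearMap fun _ => L‖ ≤
      Λ ^ n * ‖iteratedFDeriv ℝ n Φ (L x + y)‖ := by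
    refine (ContinuousMultilinearMap.norm_compContinuousLinearMap_le _ _).trans ?_
    rw [Finset.prod_const, Finset.card_univ, Fintype.card_fin, mul_comm]
    gcongr
  rw [iteratedFDeriv_schwartz_affine, norm_smul]
  calc (1 + ‖x‖) ^ N * (1 + q) ^ N *
        (‖c‖ * ‖(iteratedFDeriv ℝ n Φ (L x + y)).compContinuousLinearMap fun _ => L‖)
      ≤ (A * (1 + ‖L x + y‖)) ^ N * (A * (1 + ‖L x + y‖)) ^ N *
        (Γ * (Λ ^ n * ‖iteratedFDeriv ℝ n Φ (L x + y)‖)) := by gcongr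
    _ = A ^ (N + N) * (Γ * (Λ ^ n * ((1 + ‖L x + y‖) ^ (N + N) *
        ‖iteratedFDeriv ℝ n Φ (L x + y)‖))) := by
        rw [mul_pow, pow_add, pow_add]; ring
    _ ≤ _ := by gcongr

end ParametricSchwartz

/-! ### Moduli and equivariance on the torus. -/

section

variable {F : Type*} [RCLike F] {m : ℕ}

theorem prod_upper_eq {M : Type*} [CommMonoid M] (f : Fin m → Fin m → M) :
    ∏ p : {p : Fin m × Fin m // p.1 < p.2}, f p.1.1 p.1.2 =
      ∏ i : Fin m, ∏ j ∈ Finset.Ioi i, f i j := by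
  have h1 : ∀ i : Fin m, ∏ j ∈ Finset.Ioi i, f i j = ∏ j, if i < j then f i j else 1 := by
    intro i
    rw [← Finset.prod_filter]
    refine Finset.prod_congr ?_ fun _ _ => rfl
    ext j; simp
  simp only [h1]
  rw [← Fintype.prod_prod_type' (f := fun i j => if i < j then f i j else 1),
    ← Finset.prod_filter, Finset.prod_subtype (p := fun x : Fin m × Fin m => x.1 < x.2)]
  intro x; simp

/-- The normalized absolute value of the determinant of a diagonal matrix. -/
def detAbs (t : Torus F m) : ℝ := ∏ i, modAbs (t i : F)

theorem detAbs_pos (t : Torus F m) : 0 < detAbs t :=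
  Finset.prod_pos fun i _ => modAbs_pos (t i).ne_zero

/-- With `P = ∏_{i<j} |t_i|` and `Q = ∏_{i<j} |t_j|`, the density is `P⁻¹` and `δ_B = P/Q`. Each
index lies in `m - 1` pairs, so `PQ = |det t|^{m-1}`; hence `√(P/Q) √(PQ) = P`. This explains the
shift `(m-1)/2 = n - 1/2`. -/
theorem borelDensity_mul_sqrt_deltaB (t : Torus F m) :
    borelDensity t * Real.sqrt (deltaB t) * detAbs t ^ ((m : ℝ) / 2 - 1 / 2) = 1 := by
  set a : Fin m → ℝ := fun i => modAbs (t i : F) with ha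
  have ha0 : ∀ i, 0 < a i := fun i => modAbs_pos (t i).ne_zero
  set P := ∏ i : Fin m, ∏ _j ∈ Finset.Ioi i, a i with hP
  set Q := ∏ i : Fin m, ∏ j ∈ Finset.Ioi i, a j with hQ
  have hP0 : 0 < P := Finset.prod_pos fun i _ => Finset.prod_pos fun j _ => ha0 i
  have hQ0 : 0 < Q := Finset.prod_pos fun i _ => Finset.prod_pos fun j _ => ha0 j
  have hD0 := detAbs_pos t
  have hρ : borelDensity t = P⁻¹ := by
    rw [borelDensity, prod_upper_eq fun i _ => (modAbs (t i : F))⁻¹]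
    simp only [Finset.prod_inv_distrib, hP, ha]
  have hδ : deltaB t = P / Q := by
    rw [deltaB, hP, hQ]
    simp only [modAbs_div, Finset.prod_div_distrib, ha]
  have hPQ : P * Q * detAbs t = detAbs t ^ m := by
    have hQ' : Q = ∏ j : Fin m, ∏ _i ∈ Finset.Iio j, a j := by
      rw [hQ]
      refine Finset.prod_comm' fun i j => ?_
      simp
    rw [hQ', hP, detAbs, ← Finset.prod_mul_distrib, ← Finset.prod_mul_distrib,
      ← Finset.prod_pow]
    refine Finset.prod_congr rfl fun i _ => ?_
    rw [Finset.prod_const, Finset.prod_const, ← pow_add, ← pow_succ, Fin.card_Ioi, Fin.card_Iio]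
    congr 1
    omega
  set D := detAbs t
  have hpow : D ^ ((m : ℝ) / 2 - 1 / 2) = Real.sqrt (P * Q) := by
    have h1 : P * Q = D ^ ((m : ℝ) - 1) := by
      rw [Real.rpow_sub hD0, Real.rpow_natCast, Real.rpow_one, ← hPQ]
      field_simp
    rw [h1, Real.sqrt_eq_rpow, ← Real.rpow_mul hD0.le]
    congr 1
    ring
  rw [hρ, hδ, hpow, mul_assoc, ← Real.sqrt_mul (by positivity)]
  have : P / Q * (P * Q) = P ^ 2 := by field_simp
  rw [this, Real.sqrt_sq hP0.le]
  exact inv_mul_cancel₀ hP0.ne'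

theorem diag_val (t : Torus F m) : (diag t).val = Matrix.diagonal fun i => (t i : F) := rfl

theorem modAbs_det_diag (t : Torus F m) : modAbs (diag t).val.det = detAbs t := by
  rw [diag_val, Matrix.det_diagonal, modAbs_prod, detAbs]

theorem modAbs_det_maxCompact (k : maxCompact F m) : modAbs (k : GL (Fin m) F).val.det = 1 := by
  have hk : (k : GL (Fin m) F).valᴴ * (k : GL (Fin m) F).val = 1 := k.2
  have h := congrArg (fun A => ‖A.det‖) hk
  simp only [Matrix.det_mul, Matrix.det_conjTranspose, norm_mul, norm_star, Matrix.det_one,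
    norm_one] at h
  rw [modAbs, (mul_self_eq_one_iff.1 h).resolve_right (by
    have := norm_nonneg (k : GL (Fin m) F).val.det; linarith), one_pow]

theorem modAbs_det_borelMat (p : Torus F m × Nil F m) :
    modAbs (borelMat p).val.det = detAbs p.1 := by
  rw [borelMat_val, det_triMat, modAbs_prod, detAbs]

theorem principalSeries_borelMat_mul {χ : Torus F m →ₜ* ℂˣ} (v : principalSeriesSpace χ)
    (p : Torus F m × Nil F m) (g : GL (Fin m) F) :
    v.1 (borelMat p * g) = (χ p.1 : ℂ) * (Real.sqrt (deltaB p.1) : ℂ) * v.1 g := by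
  have hu : IsUpperUnipotent (borelMat p * (diag p.1)⁻¹) := by
    have hinv : ((diag p.1)⁻¹).val = Matrix.diagonal fun i => (((p.1)⁻¹ i : Fˣ) : F) := by
      rw [← map_inv]; rfl
    have htri : (borelMat p).val.BlockTriangular id := blockTriangular_triMat _ _
    have htri' : (Matrix.diagonal fun i => (((p.1)⁻¹ i : Fˣ) : F)).BlockTriangular id :=
      Matrix.blockTriangular_diagonal _
    refine ⟨fun i j hij => ?_, fun i => ?_⟩
    · rw [Units.val_mul, hinv]
      exact (htri.mul htri') hij
    · rw [Units.val_mul, hinv, mul_diag_apply htri htri', borelMat_val, triMat_self,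
        Matrix.diagonal_apply_eq, Pi.inv_apply, Units.mul_inv]
  have h : borelMat p * g = borelMat p * (diag p.1)⁻¹ * (diag p.1 * g) := by group
  rw [h, v.2.2.2 _ _ hu, v.2.2.1]

theorem IsSmooth.continuous {f : GL (Fin m) F → ℂ} (hf : IsSmooth f) : Continuous f := by
  have h1 : f = fun g : GL (Fin m) F => Function.extend
      (fun g : GL (Fin m) F => (g : Matrix (Fin m) (Fin m) F)) f 0 g.val := by
    funext g; exact (extend_coe f g).symm
  rw [h1]
  exact hf.continuousOn.comp_continuous Units.continuous_val fun g =>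
    (g.isUnit.map Matrix.detMonoidHom).ne_zero

end

/-! ### The kernel on `K × K × Nil` and its Schwartz bounds. -/

section

variable {F : Type*} [RCLike F] {m : ℕ}

/-- The Hilbert–Schmidt norm is bi-invariant under `K` and is at most `m` times the sup norm. The
constant is `m + 1` because `exists_schwartz_affine_bound` wants one that is at least `1`. -/
theorem norm_entry_le (A : Matrix (Fin m) (Fin m) F) (k₁ k₂ : maxCompact F m) (i j : Fin m) :
    ‖A i j‖ ≤ (m + 1) * ‖(k₁ : GL (Fin m) F).val * A * (k₂ : GL (Fin m) F).val‖ := by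
  set B := (k₁ : GL (Fin m) F).val * A * (k₂ : GL (Fin m) F).val with hB
  have h1 : hsNormSq A = hsNormSq B := by rw [hB, hsNormSq_right, hsNormSq_left]
  have h2 : hsNormSq B ≤ (m * ‖B‖) ^ 2 := by
    calc hsNormSq B ≤ ∑ _i : Fin m, ∑ _j : Fin m, ‖B‖ ^ 2 := by
          refine Finset.sum_le_sum fun i _ => Finset.sum_le_sum fun j _ => ?_
          gcongr
          exact Matrix.norm_entry_le_entrywise_sup_norm _
      _ = (m * ‖B‖) ^ 2 := by simp; ring
  have h3 : ‖A i j‖ ^ 2 ≤ (m * ‖B‖) ^ 2 := (norm_sq_le_hsNormSq A i j).trans (h1 ▸ h2)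
  have h4 : ‖A i j‖ ≤ m * ‖B‖ := (abs_le_of_sq_le_sq' h3 (by positivity)).2
  nlinarith [norm_nonneg B]

/-- Continuous linear maps for the topologies given by the norms. -/
abbrev NormedCLM (E E' : Type*) [NormedAddCommGroup E] [NormedSpace ℝ E] [NormedAddCommGroup E']
    [NormedSpace ℝ E'] : Type _ := E →L[ℝ] E'

theorem continuous_normedCLM {E E' X : Type*} [NormedAddCommGroup E] [NormedSpace ℝ E]
    [NormedAddCommGroup E'] [NormedSpace ℝ E'] [FiniteDimensional ℝ E] [TopologicalSpace X]
    {f : X → NormedCLM E E'} (h : ∀ x, Continuous fun k => f k x) : Continuous f :=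
  continuous_clm_apply.2 h

/-- The map `x ↦ k₁⁻¹ diag(x) k₂`. -/
def conjDiag (k : maxCompact F m × maxCompact F m) :
    NormedCLM (Fin m → F) (Matrix (Fin m) (Fin m) F) :=
  LinearMap.toContinuousLinearMap
    { toFun := fun x => ((k.1)⁻¹ : GL (Fin m) F).val * Matrix.diagonal x * (k.2 : GL (Fin m) F).val
      map_add' := fun x y => by
        have h : Matrix.diagonal (x + y) = Matrix.diagonal x + Matrix.diagonal y :=
          (Matrix.diagonal_add x y).symm
        rw [h, Matrix.mul_add, Matrix.add_mul]
      map_smul' := fun r x => by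
        rw [Matrix.diagonal_smul, Matrix.mul_smul, Matrix.smul_mul]; rfl }

theorem conjDiag_apply (k : maxCompact F m × maxCompact F m) (x : Fin m → F) :
    conjDiag k x = ((k.1)⁻¹ : GL (Fin m) F).val * Matrix.diagonal x * (k.2 : GL (Fin m) F).val :=
  rfl

theorem continuous_inv_val : Continuous fun k : maxCompact F m => ((k : GL (Fin m) F)⁻¹).val :=
  Units.continuous_val.comp continuous_subtype_val.inv

theorem continuous_val_val : Continuous fun k : maxCompact F m => (k : GL (Fin m) F).val :=
  Units.continuous_val.comp continuous_subtype_val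

theorem continuous_conjDiag :
    Continuous (conjDiag : maxCompact F m × maxCompact F m →
      NormedCLM (Fin m → F) (Matrix (Fin m) (Fin m) F)) := by
  refine continuous_normedCLM fun x => ?_
  exact ((continuous_inv_val.comp continuous_fst).mul continuous_const).mul
    (continuous_val_val.comp continuous_snd)

/-- The parameters of the Iwasawa decomposition other than the torus. -/
abbrev SphericalParam (F : Type*) [RCLike F] (m : ℕ) : Type _ :=
  maxCompact F m × (maxCompact F m × Nil F m)

/-- The Schwartz function `Φ` on the double coset parameters, weighted by two functions on the
maximal compact subgroup. -/
def sphericalKernel (v w : GL (Fin m) F → ℂ) (Φ : 𝓢(Matrix (Fin m) (Fin m) F, ℂ))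
    (o : SphericalParam F m) (x : Fin m → F) : ℂ :=
  w o.1 * v o.2.1 * Φ (((o.1)⁻¹ : GL (Fin m) F).val * triMat x o.2.2 * (o.2.1 : GL (Fin m) F).val)

variable {v w : GL (Fin m) F → ℂ} (hv : Continuous v) (hw : Continuous w)
  (Φ : 𝓢(Matrix (Fin m) (Fin m) F, ℂ))

theorem sphericalKernel_eq (o : SphericalParam F m) :
    sphericalKernel v w Φ o = fun x => (w o.1 * v o.2.1) * Φ (conjDiag (o.1, o.2.1) x +
      ((o.1)⁻¹ : GL (Fin m) F).val * nilMat o.2.2 * (o.2.1 : GL (Fin m) F).val) := by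
  funext x
  rw [sphericalKernel, conjDiag_apply, triMat, Matrix.mul_add, Matrix.add_mul]

-- Compactness of `K × K` bounds the linear parts and the weights; `norm_entry_le` bounds `x` (the
-- diagonal) and `X` (the entries above it) by the argument of `Φ`.
include hv hw in
theorem exists_sphericalKernel_bound (n N : ℕ) :
    ∃ C : ℝ, ∀ (o : SphericalParam F m) (x : Fin m → F),
      (1 + ‖x‖) ^ N * (1 + ‖o.2.2‖) ^ N *
        ‖iteratedFDeriv ℝ n (sphericalKernel v w Φ o) x‖ ≤ C := by
  obtain ⟨Λ, hΛ⟩ := (isCompact_univ (X := maxCompact F m × maxCompact F m)).exists_bound_of_continuousOn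
    continuous_conjDiag.continuousOn
  have hc : Continuous fun k : maxCompact F m × maxCompact F m => w k.1 * v k.2 :=
    (hw.comp (continuous_subtype_val.comp continuous_fst)).mul
      (hv.comp (continuous_subtype_val.comp continuous_snd))
  obtain ⟨Γ, hΓ⟩ := (isCompact_univ (X := maxCompact F m × maxCompact F m)).exists_bound_of_continuousOn
    hc.continuousOn
  obtain ⟨C, hC⟩ := exists_schwartz_affine_bound (E := Fin m → F) Φ (A := m + 1) (Λ := Λ) (Γ := Γ)
    (by simp) ((norm_nonneg _).trans (hΛ 1 (Set.mem_univ _)))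
    ((norm_nonneg _).trans (hΓ 1 (Set.mem_univ _))) n N
  refine ⟨C, fun o x => ?_⟩
  have hz : conjDiag (o.1, o.2.1) x +
      ((o.1)⁻¹ : GL (Fin m) F).val * nilMat o.2.2 * (o.2.1 : GL (Fin m) F).val =
      ((o.1⁻¹ : maxCompact F m) : GL (Fin m) F).val * triMat x o.2.2 *
        (o.2.1 : GL (Fin m) F).val := by
    rw [conjDiag_apply, triMat, Matrix.mul_add, Matrix.add_mul]; rfl
  have hnn : 0 ≤ ((m : ℝ) + 1) * ‖conjDiag (o.1, o.2.1) x +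
      ((o.1)⁻¹ : GL (Fin m) F).val * nilMat o.2.2 * (o.2.1 : GL (Fin m) F).val‖ := by positivity
  rw [sphericalKernel_eq]
  refine hC _ _ _ x _ (hΛ _ (Set.mem_univ _)) (hΓ (o.1, o.2.1) (Set.mem_univ _))
    (norm_nonneg _) ?_ ?_
  · rw [pi_norm_le_iff_of_nonneg hnn, hz]
    intro i
    have := norm_entry_le (triMat x o.2.2) o.1⁻¹ o.2.1 i i
    rwa [triMat_self] at this
  · rw [pi_norm_le_iff_of_nonneg hnn, hz]
    intro q
    have := norm_entry_le (triMat x o.2.2) o.1⁻¹ o.2.1 q.1.1 q.1.2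
    rwa [triMat_of_gt _ _ q.2] at this

variable (μK : Measure (maxCompact F m)) [μK.IsHaarMeasure]

theorem integrable_inv_one_add_norm_pow :
    Integrable (fun o : SphericalParam F m =>
      ((1 + ‖o.2.2‖) ^ (Module.finrank ℝ (Nil F m) + 1))⁻¹) (μK.prod (μK.prod volume)) := by
  have h1 : Integrable (fun X : Nil F m => ((1 + ‖X‖) ^ (Module.finrank ℝ (Nil F m) + 1))⁻¹) := by
    have h := integrable_one_add_norm (E := Nil F m) (μ := volume)
      (r := Module.finrank ℝ (Nil F m) + 1) (by simp)
    refine h.congr (Filter.Eventually.of_forall fun X => ?_)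
    beta_reduce
    rw [Real.rpow_neg (by positivity), ← Real.rpow_natCast]
    push_cast
    rfl
  have h2 : Integrable (fun z : maxCompact F m × Nil F m =>
      ((1 + ‖z.2‖) ^ (Module.finrank ℝ (Nil F m) + 1))⁻¹) (μK.prod volume) := h1.comp_snd μK
  exact h2.comp_snd μK

include hv hw in
theorem exists_schwartzMap_sphericalKernel :
    ∃ φ : 𝓢(Fin m → F, ℂ), ∀ x,
      φ x = ∫ o, sphericalKernel v w Φ o x ∂(μK.prod (μK.prod volume)) := by
  have hcont : ∀ n x, Continuous fun o => iteratedFDeriv ℝ n (sphericalKernel v w Φ o) x := by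
    intro n x
    simp only [sphericalKernel_eq]
    refine continuous_iteratedFDeriv_schwartz_affine Φ
      (L := fun o : SphericalParam F m => conjDiag (o.1, o.2.1))
      (y := fun o : SphericalParam F m =>
        ((o.1)⁻¹ : GL (Fin m) F).val * nilMat o.2.2 * (o.2.1 : GL (Fin m) F).val)
      (c := fun o : SphericalParam F m => w o.1 * v o.2.1) ?_ ?_ ?_ n x
    · exact continuous_conjDiag.comp (continuous_fst.prodMk continuous_snd.fst)
    · exact ((continuous_inv_val.comp continuous_fst).mul
        (continuous_nilMat.comp continuous_snd.snd)).mul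
        (continuous_val_val.comp continuous_snd.fst)
    · exact (hw.comp (continuous_subtype_val.comp continuous_fst)).mul
        (hv.comp (continuous_subtype_val.comp continuous_snd.fst))
  refine exists_schwartzMap_eq_integral (fun o => ?_)
    (fun n x => (hcont n x).aestronglyMeasurable) fun k n => ?_
  · rw [sphericalKernel_eq]
    exact contDiff_schwartz_affine Φ _ _ _
  -- Of the total order `k + N₀`, the `k` serves the Schwartz seminorm in `x`, and `N₀`, one more
  -- than the real dimension, makes the bound integrable in `X`.
  · set N₀ := Module.finrank ℝ (Nil F m) + 1
    obtain ⟨C, hC⟩ := exists_sphericalKernel_bound hv hw Φ n (k + N₀)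
    refine ⟨_, (integrable_inv_one_add_norm_pow μK).const_mul C, fun o x => ?_⟩
    rw [← div_eq_mul_inv, le_div_iff₀ (by positivity)]
    refine le_trans ?_ (hC o x)
    have h1 : ‖x‖ ^ k ≤ (1 + ‖x‖) ^ (k + N₀) := by
      calc ‖x‖ ^ k ≤ (1 + ‖x‖) ^ k := by gcongr; linarith
        _ ≤ (1 + ‖x‖) ^ (k + N₀) := pow_le_pow_right₀ (by linarith [norm_nonneg x]) (by omega)
    have h2 : (1 + ‖o.2.2‖) ^ N₀ ≤ (1 + ‖o.2.2‖) ^ (k + N₀) :=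
      pow_le_pow_right₀ (by linarith [norm_nonneg o.2.2]) (by omega)
    calc ‖x‖ ^ k * ‖iteratedFDeriv ℝ n (sphericalKernel v w Φ o) x‖ * (1 + ‖o.2.2‖) ^ N₀
        = ‖x‖ ^ k * (1 + ‖o.2.2‖) ^ N₀ * ‖iteratedFDeriv ℝ n (sphericalKernel v w Φ o) x‖ := by ring
      _ ≤ _ := by gcongr

end

/-! ### Unfolding the zeta integral to the torus. -/

section

variable {F : Type*} [RCLike F] {m : ℕ}

theorem measurePreserving_leftComm {α β γ : Type*} [MeasurableSpace α] [MeasurableSpace β]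
    [MeasurableSpace γ] (μa : Measure α) (μb : Measure β) (μc : Measure γ) [SFinite μa]
    [SFinite μb] [SFinite μc] :
    MeasurePreserving (fun z : α × (β × γ) => (z.2.1, (z.1, z.2.2)))
      (μa.prod (μb.prod μc)) (μb.prod (μa.prod μc)) :=
  ((measurePreserving_prodAssoc μb μa μc).comp
    ((Measure.measurePreserving_swap (μ := μa) (ν := μb)).prod (MeasurePreserving.id μc))).comp
    (measurePreserving_prodAssoc μa μb μc).symm

variable (μT : Measure (Torus F m)) [μT.IsHaarMeasure]
  (μK : Measure (maxCompact F m)) [μK.IsHaarMeasure]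
  (μG : Measure (GL (Fin m) F)) [μG.IsHaarMeasure]

/-- The parameters of the Iwasawa decomposition, sheared by the maximal compact subgroup. -/
def shearedIwasawa (z : Torus F m × SphericalParam F m) : maxCompact F m × GL (Fin m) F :=
  (z.2.1, (z.2.1 : GL (Fin m) F)⁻¹ * (borelMat (z.1, z.2.2.2) * z.2.2.1))

/-- The shear `(k, g) ↦ (k, k⁻¹ g)` preserves `μK.prod μG` by left invariance of `μG`. After it, `g`
is written in Iwasawa coordinates. Integrability is transported back from these coordinates, where
it can be checked. -/
theorem integrable_and_integral_of_iwasawa {c : NNReal}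
    (hc : μG = c • (μK.prod (borelMeasure μT)).map iwasawa)
    {Q : maxCompact F m × GL (Fin m) F → ℂ} (hQ : Continuous Q)
    (hint : Integrable (fun z => (borelDensity z.1 : ℂ) * Q (shearedIwasawa z))
      (μT.prod (μK.prod (μK.prod volume)))) :
    Integrable Q (μK.prod μG) ∧ ∫ z, Q z ∂(μK.prod μG) =
      c * ∫ z, (borelDensity z.1 : ℂ) * Q (shearedIwasawa z)
        ∂(μT.prod (μK.prod (μK.prod volume))) := by
  have : SigmaFinite μT := inferInstance
  have hlt : ∀ᵐ z ∂(μT.prod (μK.prod (μK.prod (volume : Measure (Nil F m))))),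
      ENNReal.ofReal (borelDensity z.1) < ⊤ :=
    Filter.Eventually.of_forall fun z => ENNReal.ofReal_lt_top
  have hmeas : Measurable fun z : Torus F m × SphericalParam F m =>
      ENNReal.ofReal (borelDensity z.1) := measurable_ofReal_borelDensity.comp measurable_fst
  set μρ := μT.withDensity fun t => ENNReal.ofReal (borelDensity t) with hμρ
  have hden : μρ.prod (μK.prod (μK.prod (volume : Measure (Nil F m)))) =
      (μT.prod (μK.prod (μK.prod volume))).withDensity
        fun z => ENNReal.ofReal (borelDensity z.1) :=
    prod_withDensity_left₀ measurable_ofReal_borelDensity.aemeasurable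
  have hsm : ∀ z : Torus F m × SphericalParam F m,
      (ENNReal.ofReal (borelDensity z.1)).toReal • Q (shearedIwasawa z) =
        (borelDensity z.1 : ℂ) * Q (shearedIwasawa z) := fun z => by
    rw [ENNReal.toReal_ofReal (borelDensity_pos _).le, Complex.real_smul]
  have h1 : Integrable (fun z => Q (shearedIwasawa z))
      (μρ.prod (μK.prod (μK.prod volume))) := by
    rw [hden, integrable_withDensity_iff_integrable_smul' hmeas hlt]
    simpa only [hsm] using hint
  have h2 : ∫ z, Q (shearedIwasawa z) ∂(μρ.prod (μK.prod (μK.prod volume))) =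
      ∫ z, (borelDensity z.1 : ℂ) * Q (shearedIwasawa z)
        ∂(μT.prod (μK.prod (μK.prod volume))) := by
    rw [hden, integral_withDensity_eq_integral_toReal_smul hmeas hlt]
    simp only [hsm]
  have hτ : MeasurePreserving (fun z : Torus F m × SphericalParam F m =>
      (z.2.1, (z.2.2.1, (z.1, z.2.2.2)))) (μρ.prod (μK.prod (μK.prod volume)))
      (μK.prod (μK.prod (borelMeasure μT))) :=
    ((MeasurePreserving.id μK).prod
      (measurePreserving_leftComm μρ μK (volume : Measure (Nil F m)))).comp
      (measurePreserving_leftComm μρ μK (μK.prod (volume : Measure (Nil F m))))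
  set ν := (μK.prod (borelMeasure μT)).map iwasawa with hν
  have hι : MeasurePreserving (Prod.map id iwasawa :
      maxCompact F m × (maxCompact F m × (Torus F m × Nil F m)) → _)
      (μK.prod (μK.prod (borelMeasure μT))) (μK.prod ν) :=
    (MeasurePreserving.id μK).prod ⟨continuous_iwasawa.measurable, rfl⟩
  have hσcont : Continuous fun z : maxCompact F m × GL (Fin m) F =>
      (z.1, (z.1 : GL (Fin m) F)⁻¹ * z.2) :=
    continuous_fst.prodMk ((continuous_subtype_val.comp continuous_fst).inv.mul continuous_snd)
  have hσ : MeasurePreserving (fun z : maxCompact F m × GL (Fin m) F =>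
      (z.1, (z.1 : GL (Fin m) F)⁻¹ * z.2)) (μK.prod μG) (μK.prod μG) :=
    (MeasurePreserving.id μK).skew_product
      (g := fun (k : maxCompact F m) (g : GL (Fin m) F) => (k : GL (Fin m) F)⁻¹ * g)
      hσcont.snd.measurable
      (Filter.Eventually.of_forall fun k => map_mul_left_eq_self μG _)
  set Q' := fun z : maxCompact F m × GL (Fin m) F => Q (z.1, (z.1 : GL (Fin m) F)⁻¹ * z.2)
    with hQ'
  have hQ'c : Continuous Q' := hQ.comp hσcont
  have hχ := hι.comp hτ
  have h3 : Integrable Q' (μK.prod ν) :=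
    (hχ.integrable_comp hQ'c.aestronglyMeasurable).1 h1
  have h4 : ∫ z, Q' z ∂(μK.prod ν) =
      ∫ z, Q (shearedIwasawa z) ∂(μρ.prod (μK.prod (μK.prod volume))) := by
    rw [← hχ.map_eq, integral_map hχ.measurable.aemeasurable hQ'c.aestronglyMeasurable]
    rfl
  have hprod : μK.prod μG = c • μK.prod ν := by rw [hc, Measure.prod_smul_right]
  have h5 : Integrable Q' (μK.prod μG) := by
    rw [hprod]; exact h3.smul_measure_nnreal
  refine ⟨(hσ.integrable_comp hQ.aestronglyMeasurable).1 h5, ?_⟩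
  have h6 : ∫ z, Q z ∂(μK.prod μG) = ∫ z, Q' z ∂(μK.prod μG) := by
    conv_lhs => rw [← hσ.map_eq]
    exact integral_map hσ.measurable.aemeasurable hQ.aestronglyMeasurable
  rw [h6, hprod, integral_smul_nnreal_measure, h4, h2, NNReal.smul_def, Complex.real_smul]

/-- The density of the zeta integral on the torus. -/
def torusWeight (χ : Torus F m →ₜ* ℂˣ) (s : ℂ) (t : Torus F m) : ℂ :=
  (χ t : ℂ) * (detAbs t : ℂ) ^ s

theorem continuous_detAbs : Continuous (detAbs : Torus F m → ℝ) :=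
  continuous_finsetProd _ fun i _ =>
    continuous_modAbs.comp (Units.continuous_val.comp (continuous_apply i))

theorem continuous_torusWeight (χ : Torus F m →ₜ* ℂˣ) (s : ℂ) :
    Continuous (torusWeight χ s) := by
  refine (Units.continuous_val.comp χ.continuous_toFun).mul ?_
  exact (Complex.continuous_ofReal.comp continuous_detAbs).cpow continuous_const fun t =>
    Complex.ofReal_mem_slitPlane.2 (detAbs_pos t)

theorem continuous_torus_val : Continuous fun (t : Torus F m) (i : Fin m) => (t i : F) :=
  continuous_pi fun i => Units.continuous_val.comp (continuous_apply i)

/-- The zeta integral of a matrix coefficient of a principal series representation, in the region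
of absolute convergence, as an integral over the torus. -/
theorem exists_schwartzMap_zeta_eq {χ : Torus F m →ₜ* ℂˣ} (v : principalSeriesSpace χ)
    (w : principalSeriesSpace χ⁻¹) (Φ : 𝓢(Matrix (Fin m) (Fin m) F, ℂ)) :
    ∃ φ : 𝓢(Fin m → F, ℂ), ∀ s : ℂ,
      (∃ N : ℕ, Integrable (fun t : Torus F m =>
        ((1 + ‖fun i => (t i : F)‖) ^ N)⁻¹ * ‖torusWeight χ s t‖) μT) →
      Integrable (fun t : Torus F m => φ (fun i => (t i : F)) * torusWeight χ s t) μT ∧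
      Integrable (fun g : GL (Fin m) F => Φ g.val * (∫ k : maxCompact F m, v.1 (k * g) * w.1 k ∂μK) *
          (modAbs g.val.det : ℂ) ^ (s + (m / 2 - 1 / 2))) μG ∧
      ∫ g : GL (Fin m) F, Φ g.val * (∫ k : maxCompact F m, v.1 (k * g) * w.1 k ∂μK) *
          (modAbs g.val.det : ℂ) ^ (s + (m / 2 - 1 / 2)) ∂μG =
        ∫ t : Torus F m, φ (fun i => (t i : F)) * torusWeight χ s t ∂μT := by
  have : SigmaFinite μT := inferInstance
  obtain ⟨c, hc⟩ := exists_haar_eq_iwasawa μT μK μG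
  have hv := v.2.1.continuous
  have hw := w.2.1.continuous
  obtain ⟨φ, hφ⟩ := exists_schwartzMap_sphericalKernel hv hw Φ μK
  -- The constant `c` compares `μG` with the Iwasawa measure, so one `φ` serves all `s`.
  refine ⟨(c : ℂ) • φ, fun s ⟨N, hN⟩ => ?_⟩
  set e : ℂ := s + (m / 2 - 1 / 2) with he
  set Q : maxCompact F m × GL (Fin m) F → ℂ := fun z =>
    Φ z.2.val * (v.1 (z.1 * z.2) * w.1 z.1) * (modAbs z.2.val.det : ℂ) ^ e with hQdef
  have hdet0 : ∀ g : GL (Fin m) F, 0 < modAbs g.val.det := fun g =>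
    modAbs_pos (g.isUnit.map Matrix.detMonoidHom).ne_zero
  have hval : Continuous fun z : maxCompact F m × GL (Fin m) F => z.2.val :=
    Units.continuous_val.comp continuous_snd
  have hQ : Continuous Q := by
    refine ((Φ.continuous.comp hval).mul ((hv.comp
      ((continuous_subtype_val.comp continuous_fst).mul continuous_snd)).mul
      (hw.comp (continuous_subtype_val.comp continuous_fst)))).mul ?_
    exact (Complex.continuous_ofReal.comp
      (continuous_modAbs.comp hval.matrix_det)).cpow continuous_const fun z =>
      Complex.ofReal_mem_slitPlane.2 (hdet0 z.2)
  -- The shear cancels `k₁` inside `v`, and equivariance extracts `χ(t) δ_B(t)^{1/2}`; by `hid` the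
  -- density and the shifted determinant absorb `δ_B^{1/2}`.
  have hZ : ∀ z : Torus F m × SphericalParam F m,
      (borelDensity z.1 : ℂ) * Q (shearedIwasawa z) =
        sphericalKernel v.1 w.1 Φ z.2 (fun i => (z.1 i : F)) * torusWeight χ s z.1 := by
    rintro ⟨t, k₁, k₂, X⟩
    have hmod : modAbs ((k₁ : GL (Fin m) F)⁻¹ * (borelMat (t, X) * (k₂ : GL (Fin m) F))).val.det =
        detAbs t := by
      rw [Units.val_mul, Units.val_mul, Matrix.det_mul, Matrix.det_mul, modAbs_mul, modAbs_mul,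
        modAbs_det_maxCompact, modAbs_det_borelMat]
      have := modAbs_det_maxCompact k₁⁻¹
      rw [show (((k₁ : GL (Fin m) F)⁻¹).val : Matrix (Fin m) (Fin m) F) =
        ((k₁⁻¹ : maxCompact F m) : GL (Fin m) F).val from rfl, this, one_mul, mul_one]
    have hD : (detAbs t : ℂ) ≠ 0 := by exact_mod_cast (detAbs_pos t).ne'
    have hid : (borelDensity t : ℂ) * (Real.sqrt (deltaB t) : ℂ) *
        (detAbs t : ℂ) ^ ((m : ℂ) / 2 - 1 / 2) = 1 := by
      have h := borelDensity_mul_sqrt_deltaB t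
      have h2 : (detAbs t : ℂ) ^ ((m : ℂ) / 2 - 1 / 2) =
          ((detAbs t ^ ((m : ℝ) / 2 - 1 / 2) : ℝ) : ℂ) := by
        rw [Complex.ofReal_cpow (detAbs_pos t).le]
        push_cast
        rfl
      rw [h2]
      exact_mod_cast h
    simp only [hQdef, shearedIwasawa, sphericalKernel, torusWeight]
    rw [mul_inv_cancel_left, principalSeries_borelMat_mul, hmod, he, Complex.cpow_add _ _ hD,
      Units.val_mul, Units.val_mul, borelMat_val, ← Matrix.mul_assoc]
    linear_combination (Φ ((k₁ : GL (Fin m) F)⁻¹.val * triMat (fun i => (t i : F)) X *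
      (k₂ : GL (Fin m) F).val) * v.1 k₂ * w.1 k₁ * (χ t : ℂ) * (detAbs t : ℂ) ^ s) * hid
  set Ω := μK.prod (μK.prod (volume : Measure (Nil F m))) with hΩ
  set N₀ := Module.finrank ℝ (Nil F m) + 1
  -- Order `N` meets the hypothesis on the torus weight, order `N₀` gives integrability in `X`.
  obtain ⟨C, hC⟩ := exists_sphericalKernel_bound hv hw Φ 0 (N + N₀)
  have hZc : Continuous fun z : Torus F m × SphericalParam F m =>
      (borelDensity z.1 : ℂ) * Q (shearedIwasawa z) := by
    refine (Complex.continuous_ofReal.comp (continuous_borelDensity.comp continuous_fst)).mul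
      (hQ.comp ?_)
    exact continuous_snd.fst.prodMk ((continuous_subtype_val.comp continuous_snd.fst).inv.mul
      ((continuous_borelMat.comp (continuous_fst.prodMk continuous_snd.snd.snd)).mul
        (continuous_subtype_val.comp continuous_snd.snd.fst)))
  have hZint : Integrable (fun z : Torus F m × SphericalParam F m =>
      (borelDensity z.1 : ℂ) * Q (shearedIwasawa z)) (μT.prod Ω) := by
    have hdom := (hN.mul_prod (integrable_inv_one_add_norm_pow (F := F) μK)).const_mul C
    refine hdom.mono' hZc.aestronglyMeasurable (Filter.Eventually.of_forall fun z => ?_)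
    rw [hZ, norm_mul]
    have hb := hC z.2 (fun i => (z.1 i : F))
    rw [norm_iteratedFDeriv_zero] at hb
    set x : Fin m → F := fun i => (z.1 i : F)
    have h1 : (1 + ‖x‖) ^ N ≤ (1 + ‖x‖) ^ (N + N₀) :=
      pow_le_pow_right₀ (by linarith [norm_nonneg x]) (by omega)
    have h2 : (1 + ‖z.2.2.2‖) ^ N₀ ≤ (1 + ‖z.2.2.2‖) ^ (N + N₀) :=
      pow_le_pow_right₀ (by linarith [norm_nonneg z.2.2.2]) (by omega)
    have h3 : (1 + ‖x‖) ^ N * (1 + ‖z.2.2.2‖) ^ N₀ * ‖sphericalKernel v.1 w.1 Φ z.2 x‖ ≤ C :=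
      le_trans (by gcongr) hb
    have h4 : ‖sphericalKernel v.1 w.1 Φ z.2 x‖ ≤
        C * (((1 + ‖x‖) ^ N)⁻¹ * ((1 + ‖z.2.2.2‖) ^ N₀)⁻¹) := by
      rw [← mul_inv, ← div_eq_mul_inv, le_div_iff₀ (by positivity), mul_comm]
      exact h3
    calc ‖sphericalKernel v.1 w.1 Φ z.2 x‖ * ‖torusWeight χ s z.1‖
        ≤ C * (((1 + ‖x‖) ^ N)⁻¹ * ((1 + ‖z.2.2.2‖) ^ N₀)⁻¹) * ‖torusWeight χ s z.1‖ := by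
          gcongr
      _ = _ := by ring
  obtain ⟨hQint, hQeq⟩ := integrable_and_integral_of_iwasawa μT μK μG hc hQ hZint
  have hinner : ∀ g : GL (Fin m) F, ∫ k : maxCompact F m, Q (k, g) ∂μK =
      Φ g.val * (∫ k : maxCompact F m, v.1 (k * g) * w.1 k ∂μK) *
        (modAbs g.val.det : ℂ) ^ e := by
    intro g
    simp only [hQdef]
    rw [integral_mul_const, integral_const_mul]
  have hφt : ∀ t : Torus F m, ∫ o, (borelDensity t : ℂ) * Q (shearedIwasawa (t, o)) ∂Ω =
      φ (fun i => (t i : F)) * torusWeight χ s t := by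
    intro t
    have h := fun o => hZ (t, o)
    simp only at h
    simp only [h]
    rw [integral_mul_const, hφ]
  have hTint := hZint.integral_prod_left
  have hTeq := integral_prod _ hZint
  simp only [hφt] at hTint hTeq
  refine ⟨?_, ?_, ?_⟩
  · refine (hTint.const_mul (c : ℂ)).congr (Filter.Eventually.of_forall fun t => ?_)
    simp only [smul_apply, smul_eq_mul, mul_assoc]
  · have h := hQint.integral_prod_right
    simpa only [hinner] using h
  · have h := integral_prod_symm _ hQint
    simp only [hinner] at h
    rw [← h, hQeq, hTeq, ← integral_const_mul]
    simp only [smul_apply, smul_eq_mul, mul_assoc]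

end

/-! ### Absolute convergence of torus integrals. -/

section

variable {F : Type*} [RCLike F] {m : ℕ}

/-- The unit of `F` given by a positive real number. -/
def realUnit (F : Type*) [RCLike F] (r : ℝ) (hr : 0 < r) : Fˣ :=
  Units.mk0 (r : F) (by exact_mod_cast hr.ne')

theorem norm_realUnit (r : ℝ) (hr : 0 < r) : ‖(realUnit F r hr : F)‖ = r := by
  rw [realUnit, Units.val_mk0, RCLike.norm_ofReal, abs_of_pos hr]

/-- A continuous homomorphism to the positive real numbers is a power of the norm. -/
theorem exists_eq_norm_rpow {f : Fˣ → ℝ} (hf : Continuous f) (hpos : ∀ x, 0 < f x)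
    (hmul : ∀ x y, f (x * y) = f x * f y) : ∃ σ : ℝ, ∀ x : Fˣ, f x = ‖(x : F)‖ ^ σ := by
  have h1 : f 1 = 1 := by
    have h := hmul 1 1
    rw [mul_one] at h
    exact (mul_eq_left₀ (hpos 1).ne').1 h.symm
  set f' : Fˣ →* ℝ := ⟨⟨f, h1⟩, hmul⟩ with hf'
  -- The powers of a unit of norm `1` stay in a compact set, so `f u > 1` would make `f` unbounded
  -- there. Applying this to `u⁻¹` as well gives `f u = 1`.
  have hunit_le : ∀ u : Fˣ, ‖(u : F)‖ = 1 → f u ≤ 1 := by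
    intro u hu
    obtain ⟨M, hM⟩ := (isCompact_units_bounded (F := F) 1).exists_bound_of_continuousOn
      hf.continuousOn
    by_contra! hlt
    obtain ⟨k, hk⟩ := pow_unbounded_of_one_lt M hlt
    have h2 := hM (u ^ k) ⟨by simp [hu], by simp [hu]⟩
    have h3 : f (u ^ k) = f u ^ k := map_pow f' u k
    rw [h3, Real.norm_of_nonneg (pow_nonneg (hpos u).le k)] at h2
    linarith
  have hunit : ∀ u : Fˣ, ‖(u : F)‖ = 1 → f u = 1 := by
    intro u hu
    refine le_antisymm (hunit_le u hu) ?_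
    have h2 := hunit_le u⁻¹ (by simp [hu])
    have h3 : f u * f u⁻¹ = 1 := by rw [← hmul, mul_inv_cancel, h1]
    nlinarith [hpos u, hpos u⁻¹]
  set r : ℝ → Fˣ := fun y => realUnit F (Real.exp y) (Real.exp_pos y) with hr
  have hrc : Continuous r := by
    refine Units.isEmbedding_val₀.continuous_iff.2 ?_
    exact RCLike.continuous_ofReal.comp Real.continuous_exp
  have hradd : ∀ x y, r (x + y) = r x * r y := by
    intro x y
    refine Units.ext ?_
    simp only [hr, realUnit, Units.val_mk0, Units.val_mul, Real.exp_add]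
    push_cast
    rfl
  -- On positive reals, `log ∘ f ∘ exp` is a continuous additive map, hence linear; its slope is the
  -- exponent.
  set g : ℝ →+ ℝ := AddMonoidHom.mk' (fun y => Real.log (f (r y))) fun x y => by
    rw [hradd, hmul, Real.log_mul (hpos _).ne' (hpos _).ne'] with hg
  have hgc : Continuous g := (hf.comp hrc).log fun y => (hpos _).ne'
  refine ⟨g 1, fun x => ?_⟩
  have hx : 0 < ‖(x : F)‖ := norm_pos_iff.2 x.ne_zero
  set y := Real.log ‖(x : F)‖ with hy
  have hnr : ‖(r y : F)‖ = ‖(x : F)‖ := by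
    rw [hr, norm_realUnit, hy, Real.exp_log hx]
  have h2 : f (x * (r y)⁻¹) = 1 := by
    refine hunit _ ?_
    rw [Units.val_mul, norm_mul, Units.val_inv_eq_inv_val, norm_inv, hnr, mul_inv_cancel₀ hx.ne']
  have h3 : f x = f (r y) := by
    conv_lhs => rw [← inv_mul_cancel_right x (r y), hmul, h2, one_mul]
  have h4 : g y = y * g 1 := by
    have := (g.toRealLinearMap hgc).map_smul y 1
    simpa using this
  rw [h3, Real.rpow_def_of_pos hx, ← hy, ← h4]
  exact (Real.exp_log (hpos _)).symm

/-- The absolute value of a quasi-character of the torus. -/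
theorem exists_norm_character_eq (χ : Torus F m →ₜ* ℂˣ) :
    ∃ σ : Fin m → ℝ, ∀ t, ‖(χ t : ℂ)‖ = ∏ i, ‖(t i : F)‖ ^ σ i := by
  have h : ∀ i : Fin m, ∃ σ : ℝ, ∀ x : Fˣ, ‖(χ (Pi.mulSingle i x) : ℂ)‖ = ‖(x : F)‖ ^ σ := by
    intro i
    refine exists_eq_norm_rpow ?_ (fun x => norm_pos_iff.2 (Units.ne_zero _)) fun x y => ?_
    · exact (Units.continuous_val.comp (χ.continuous_toFun.comp (continuous_mulSingle i))).norm
    · rw [Pi.mulSingle_mul, map_mul, Units.val_mul, norm_mul]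
  choose σ hσ using h
  refine ⟨σ, fun t => ?_⟩
  conv_lhs => rw [← Finset.univ_prod_mulSingle t, map_prod]
  rw [Units.coe_prod, norm_prod]
  exact Finset.prod_congr rfl fun i _ => hσ i (t i)

theorem norm_torusWeight {χ : Torus F m →ₜ* ℂˣ} {σ : Fin m → ℝ}
    (hσ : ∀ t, ‖(χ t : ℂ)‖ = ∏ i, ‖(t i : F)‖ ^ σ i) (s : ℂ) (t : Torus F m) :
    ‖torusWeight χ s t‖ = ∏ i, ‖(t i : F)‖ ^ (σ i + Module.finrank ℝ F * s.re) := by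
  rw [torusWeight, norm_mul, hσ, Complex.norm_cpow_eq_rpow_re_of_pos (detAbs_pos t), detAbs,
    ← Real.finsetProd_rpow _ _ fun i _ => modAbs_nonneg _, ← Finset.prod_mul_distrib]
  refine Finset.prod_congr rfl fun i _ => ?_
  have hx : 0 < ‖(t i : F)‖ := norm_pos_iff.2 (t i).ne_zero
  rw [modAbs, Real.rpow_add hx, Real.rpow_mul hx.le, Real.rpow_natCast]

/-- The dyadic annuli are multiplicative translates of one another, so they have equal finite
measure. On the `n`-th one the integrand is at most `2^a 2^{-a|n|}`: the factor `‖x‖ ^ a` decays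
near `0`, and `M ≥ 2a` gives decay at infinity. -/
theorem integrable_units_rpow (μ : Measure Fˣ) [μ.IsHaarMeasure] {a : ℝ} (ha : 0 < a) {M : ℕ}
    (hM : 2 * a ≤ M) :
    Integrable (fun x : Fˣ => ((1 + ‖(x : F)‖) ^ M)⁻¹ * ‖(x : F)‖ ^ a) μ := by
  set A : ℤ → Set Fˣ := fun n => {x | (2 : ℝ) ^ n ≤ ‖(x : F)‖ ∧ ‖(x : F)‖ < 2 ^ (n + 1)} with hA
  set h : Fˣ → ℝ := fun x => ((1 + ‖(x : F)‖) ^ M)⁻¹ * ‖(x : F)‖ ^ a with hh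
  have hnc : Continuous fun x : Fˣ => ‖(x : F)‖ := Units.continuous_val.norm
  have hcont : Continuous h := by
    refine (((continuous_const.add hnc).pow M).inv₀ fun x => ?_).mul
      (hnc.rpow_const fun x => Or.inr ha.le)
    exact (show 0 < (1 + ‖(x : F)‖) ^ M by positivity).ne'
  have hAm : ∀ n, MeasurableSet (A n) := fun n =>
    (isClosed_le continuous_const hnc).measurableSet.inter
      (isOpen_lt hnc continuous_const).measurableSet
  have hAμ : ∀ n, μ (A n) = μ (A 0) := by
    intro n
    set u : Fˣ := (realUnit F 2 two_pos) ^ n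
    have hu : ‖(u : F)‖ = 2 ^ n := by
      rw [Units.val_zpow_eq_zpow_val, norm_zpow, norm_realUnit]
    rw [← measure_preimage_mul μ u (A n)]
    congr 1
    ext x
    have h2 : (0 : ℝ) < 2 ^ n := by positivity
    simp only [hA, Set.mem_preimage, Set.mem_ofPred_eq, Units.val_mul, norm_mul, hu, zpow_zero]
    rw [zpow_add₀ two_ne_zero, zpow_one, zero_add, zpow_one]
    constructor
    · rintro ⟨h3, h4⟩
      exact ⟨le_of_mul_le_mul_left (by linarith) h2, lt_of_mul_lt_mul_left h4 h2.le⟩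
    · rintro ⟨h3, h4⟩
      exact ⟨by nlinarith, by nlinarith⟩
  have hA0 : μ (A 0) ≠ ⊤ := by
    refine ne_top_of_le_ne_top (isCompact_units_bounded (F := F) 2).measure_lt_top.ne
      (measure_mono fun x hx => ?_)
    simp only [hA, Set.mem_ofPred_eq, zpow_zero, zero_add, zpow_one] at hx
    refine ⟨hx.2.le, ?_⟩
    rw [Units.val_inv_eq_inv_val, norm_inv]
    exact (inv_le_one_of_one_le₀ hx.1).trans one_le_two
  set q : ℝ := 2 ^ (-a) with hq
  have hq0 : 0 < q := by positivity
  have hq1 : q < 1 := Real.rpow_lt_one_of_one_lt_of_neg one_lt_two (by linarith)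
  have hbound : ∀ n : ℤ, ∀ x ∈ A n, h x ≤ 2 ^ a * q ^ n.natAbs := by
    rintro n x ⟨h1, h2⟩
    have hx : 0 < ‖(x : F)‖ := norm_pos_iff.2 x.ne_zero
    rcases Int.natAbs_eq n with hn | hn
    · set k := n.natAbs
      rw [hn, zpow_natCast] at h1
      have hx1 : 1 ≤ ‖(x : F)‖ := (one_le_pow₀ one_le_two).trans h1
      have h3 : ‖(x : F)‖ ^ (2 * a) ≤ (1 + ‖(x : F)‖) ^ M := by
        calc ‖(x : F)‖ ^ (2 * a) ≤ ‖(x : F)‖ ^ (M : ℝ) := Real.rpow_le_rpow_of_exponent_le hx1 hM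
          _ = ‖(x : F)‖ ^ M := Real.rpow_natCast _ _
          _ ≤ _ := by gcongr; linarith
      calc h x ≤ (‖(x : F)‖ ^ (2 * a))⁻¹ * ‖(x : F)‖ ^ a := by
            simp only [hh]; gcongr
        _ = ‖(x : F)‖ ^ (-a) := by
            rw [← Real.rpow_neg hx.le, ← Real.rpow_add hx]; congr 1; ring
        _ ≤ ((2 : ℝ) ^ k) ^ (-a) :=
            Real.rpow_le_rpow_of_nonpos (by positivity) h1 (by linarith)
        _ = q ^ k := by
            rw [hq, ← Real.rpow_natCast, ← Real.rpow_natCast, ← Real.rpow_mul two_pos.le,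
              ← Real.rpow_mul two_pos.le, mul_comm]
        _ ≤ 2 ^ a * q ^ k := le_mul_of_one_le_left (by positivity)
            (Real.one_le_rpow one_le_two ha.le)
    · set k := n.natAbs
      rw [hn, zpow_add₀ two_ne_zero, zpow_one, zpow_neg, zpow_natCast] at h2
      calc h x ≤ 1 * ‖(x : F)‖ ^ a := by
            simp only [hh]
            gcongr
            exact inv_le_one_of_one_le₀ (one_le_pow₀ (by linarith))
        _ ≤ (((2 : ℝ) ^ k)⁻¹ * 2) ^ a := by
            rw [one_mul]; gcongr
        _ = 2 ^ a * q ^ k := by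
            rw [Real.mul_rpow (by positivity) two_pos.le, mul_comm, hq,
              Real.inv_rpow (by positivity), ← Real.rpow_neg (by positivity),
              ← Real.rpow_natCast, ← Real.rpow_natCast, ← Real.rpow_mul two_pos.le,
              ← Real.rpow_mul two_pos.le, mul_comm (k : ℝ)]
  have hsum : Summable fun n : ℤ => 2 ^ a * q ^ n.natAbs * (μ (A 0)).toReal := by
    refine Summable.mul_right _ (Summable.mul_left _ ?_)
    refine Summable.of_nat_of_neg ?_ ?_
    · simpa using summable_geometric_of_lt_one hq0.le hq1
    · simpa using summable_geometric_of_lt_one hq0.le hq1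
  refine ⟨hcont.aestronglyMeasurable, ?_⟩
  have hcover : (⋃ n, A n) = Set.univ := by
    refine Set.eq_univ_of_forall fun x => ?_
    obtain ⟨n, hn⟩ := exists_mem_Ico_zpow (norm_pos_iff.2 x.ne_zero) (one_lt_two (α := ℝ))
    exact Set.mem_iUnion.2 ⟨n, hn⟩
  have hnn : ∀ x, 0 ≤ h x := fun x => by simp only [hh]; positivity
  calc ∫⁻ x, ‖h x‖ₑ ∂μ = ∫⁻ x in ⋃ n, A n, ‖h x‖ₑ ∂μ := by rw [hcover, Measure.restrict_univ]
    _ ≤ ∑' n, ∫⁻ x in A n, ‖h x‖ₑ ∂μ := lintegral_iUnion_le _ _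
    _ ≤ ∑' n : ℤ, ENNReal.ofReal (2 ^ a * q ^ n.natAbs * (μ (A 0)).toReal) := by
        refine ENNReal.tsum_le_tsum fun n => ?_
        calc ∫⁻ x in A n, ‖h x‖ₑ ∂μ ≤ ∫⁻ _ in A n, ENNReal.ofReal (2 ^ a * q ^ n.natAbs) ∂μ := by
              refine setLIntegral_mono' (hAm n) fun x hx => ?_
              rw [Real.enorm_of_nonneg (hnn x)]
              exact ENNReal.ofReal_le_ofReal (hbound n x hx)
          _ = ENNReal.ofReal (2 ^ a * q ^ n.natAbs) * μ (A 0) := by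
              rw [setLIntegral_const, hAμ]
          _ = _ := by
              rw [ENNReal.ofReal_mul (p := 2 ^ a * q ^ n.natAbs) (by positivity),
                ENNReal.ofReal_toReal hA0]
    _ < ⊤ := by
        rw [← ENNReal.ofReal_tsum_of_nonneg (fun n => by positivity) hsum]
        exact ENNReal.ofReal_lt_top

/-- By uniqueness of Haar measure `μT` may be taken to be a product, and `(1 + ‖t‖)^{Mm}` dominates
the product of the `(1 + ‖t_i‖)^M`, so the one-variable case applies. -/
theorem exists_integrable_torus (μT : Measure (Torus F m)) [μT.IsHaarMeasure] {a : Fin m → ℝ}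
    (ha : ∀ i, 0 < a i) : ∃ N : ℕ, Integrable (fun t : Torus F m =>
      ((1 + ‖fun i => (t i : F)‖) ^ N)⁻¹ * ∏ i, ‖(t i : F)‖ ^ a i) μT := by
  set μ₁ : Measure Fˣ := Measure.haar
  set μ : Measure (Torus F m) := Measure.pi fun _ => μ₁
  have hμ := Measure.isMulLeftInvariant_eq_smul μT μ
  obtain ⟨M, hM⟩ : ∃ M : ℕ, ∀ i, 2 * a i ≤ M := by
    obtain ⟨M, hM⟩ := exists_nat_ge (∑ i, 2 * a i)
    exact ⟨M, fun i => (Finset.single_le_sum (f := fun i => 2 * a i)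
      (fun j _ => by have := ha j; positivity) (Finset.mem_univ i)).trans hM⟩
  refine ⟨M * m, ?_⟩
  rw [hμ]
  refine Integrable.smul_measure_nnreal ?_
  have h1 : Integrable (fun t : Torus F m => ∏ i, (((1 + ‖(t i : F)‖) ^ M)⁻¹ * ‖(t i : F)‖ ^ a i)) μ :=
    Integrable.fintype_prod (μ := fun _ => μ₁)
      (f := fun i (x : Fˣ) => ((1 + ‖(x : F)‖) ^ M)⁻¹ * ‖(x : F)‖ ^ a i)
      fun i => integrable_units_rpow μ₁ (ha i) (hM i)
  have hc : Continuous fun t : Torus F m =>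
      ((1 + ‖fun i => (t i : F)‖) ^ (M * m))⁻¹ * ∏ i, ‖(t i : F)‖ ^ a i := by
    refine (((continuous_const.add continuous_torus_val.norm).pow _).inv₀ fun t => ?_).mul
      (continuous_finsetProd _ fun i _ => ?_)
    · exact (show 0 < (1 + ‖fun i => (t i : F)‖) ^ (M * m) by positivity).ne'
    · exact (Units.continuous_val.comp (continuous_apply i)).norm.rpow_const
        fun t => Or.inr (ha i).le
  refine h1.mono' hc.aestronglyMeasurable (Filter.Eventually.of_forall fun t => ?_)
  rw [Real.norm_of_nonneg (by positivity), Finset.prod_mul_distrib, Finset.prod_inv_distrib]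
  gcongr
  calc ∏ i, (1 + ‖(t i : F)‖) ^ M ≤ ∏ _i : Fin m, (1 + ‖fun i => (t i : F)‖) ^ M := by
        refine Finset.prod_le_prod (fun i _ => by positivity) fun i _ => ?_
        gcongr
        exact norm_le_pi_norm (fun i => (t i : F)) i
    _ = _ := by rw [Finset.prod_const, Finset.card_univ, Fintype.card_fin, pow_mul]

/-- If `a i ≤ 0`, the integrand stays bounded below near `p` as `t_i → 0`. That region contains
infinitely many disjoint translates of one open box, so it has infinite Haar measure, contradicting
integrability. -/
theorem exponent_pos_of_integrable (μT : Measure (Torus F m)) [μT.IsHaarMeasure] {a : Fin m → ℝ}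
    {φ : (Fin m → F) → ℂ} (hφ : Continuous φ) {i : Fin m} (hp : φ (Function.update 1 i 0) ≠ 0)
    {W : Torus F m → ℂ} (hW : ∀ t, ‖W t‖ = ∏ l, ‖(t l : F)‖ ^ a l)
    (hint : Integrable (fun t : Torus F m => φ (fun l => (t l : F)) * W t) μT) : 0 < a i := by
  by_contra! hai
  set p : Fin m → F := Function.update 1 i 0 with hpdef
  -- The `i`-th factor is left out: it need not be continuous at `p`, and it is at least `1` near
  -- `p` on the torus anyway.
  set Ψ : (Fin m → F) → ℝ := fun x => ‖φ x‖ * ∏ l ∈ Finset.univ.erase i, ‖x l‖ ^ a l with hΨ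
  have hpl : ∀ l ≠ i, p l = 1 := fun l hl => by rw [hpdef, Function.update_of_ne hl]; rfl
  have hΨc : ContinuousAt Ψ p := by
    refine hφ.norm.continuousAt.mul (tendsto_finsetProd _ fun l hl => ?_)
    refine ContinuousAt.rpow_const (continuous_apply l).norm.continuousAt (Or.inl ?_)
    rw [hpl l (Finset.ne_of_mem_erase hl)]
    simp
  have hΨp : 0 < Ψ p := by
    refine mul_pos (norm_pos_iff.2 hp) (Finset.prod_pos fun l hl => ?_)
    rw [hpl l (Finset.ne_of_mem_erase hl)]
    simp
  obtain ⟨ε, hε0, hε⟩ := Metric.eventually_nhds_iff.1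
    (hΨc.eventually (lt_mem_nhds (half_lt_self hΨp)))
  set η := min ε 1 with hη
  have hη0 : 0 < η := lt_min hε0 one_pos
  -- The bounds `η / 4` and `η / 2` differ by a factor `2`, so the dyadic boxes are disjoint.
  set B : ℕ → Set (Torus F m) := fun k => {t | (∀ l ≠ i, ‖(t l : F) - 1‖ < η) ∧
    η / 4 < 2 ^ k * ‖(t i : F)‖ ∧ 2 ^ k * ‖(t i : F)‖ < η / 2} with hB
  have hco : ∀ l : Fin m, Continuous fun t : Torus F m => (t l : F) := fun l =>
    Units.continuous_val.comp (continuous_apply l)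
  have hBo : ∀ k, IsOpen (B k) := by
    intro k
    have h1 : B k = (⋂ l : Fin m, {t | l ≠ i → ‖(t l : F) - 1‖ < η}) ∩
        ({t | η / 4 < 2 ^ k * ‖(t i : F)‖} ∩ {t | 2 ^ k * ‖(t i : F)‖ < η / 2}) := by
      ext t; simp [hB]
    rw [h1]
    refine (isOpen_iInter_of_finite fun l => ?_).inter
      ((isOpen_lt continuous_const (continuous_const.mul (hco i).norm)).inter
        (isOpen_lt (continuous_const.mul (hco i).norm) continuous_const))
    by_cases hl : l = i
    · simp [hl]
    · simpa [hl] using isOpen_lt ((hco l).sub continuous_const).norm continuous_const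
  have hBμ : ∀ k, μT (B k) = μT (B 0) := by
    intro k
    set z : Torus F m := Pi.mulSingle i ((realUnit F 2 two_pos) ^ k)
    rw [← measure_preimage_mul μT z (B 0)]
    congr 1
    ext t
    have hzi : ‖((z * t) i : F)‖ = 2 ^ k * ‖(t i : F)‖ := by
      simp only [z, Pi.mul_apply, Pi.mulSingle_eq_same, Units.val_mul, norm_mul, Units.val_pow_eq_pow_val,
        norm_pow, norm_realUnit]
    have hzl : ∀ l ≠ i, (z * t) l = t l := fun l hl => by
      simp only [z, Pi.mul_apply, Pi.mulSingle_eq_of_ne hl, one_mul]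
    simp only [hB, Set.mem_preimage, Set.mem_ofPred_eq, hzi, pow_zero, one_mul]
    refine and_congr (forall₂_congr fun l hl => by rw [hzl l hl]) Iff.rfl
  have hB0 : μT (B 0) ≠ 0 := by
    refine ((hBo 0).measure_pos μT ⟨Pi.mulSingle i (realUnit F (3 * η / 8) (by positivity)), ?_⟩).ne'
    refine ⟨fun l hl => ?_, ?_⟩
    · rw [Pi.mulSingle_eq_of_ne hl]; simpa using hη0
    · rw [Pi.mulSingle_eq_same, norm_realUnit]
      constructor <;> linarith
  have hdisj : Pairwise (Function.onFun Disjoint B) := by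
    have key : ∀ k k' : ℕ, k < k' → Disjoint (B k) (B k') := by
      intro k k' hkk
      rw [Set.disjoint_left]
      rintro t ⟨_, h1, _⟩ ⟨_, _, h2⟩
      have h3 : (2 : ℝ) * 2 ^ k ≤ 2 ^ k' := by
        rw [← pow_succ']; exact pow_le_pow_right₀ one_le_two hkk
      nlinarith [norm_nonneg (t i : F)]
    intro k k' hkk
    rcases lt_or_gt_of_ne hkk with h | h
    · exact key _ _ h
    · exact (key _ _ h).symm
  have hlower : ∀ t ∈ ⋃ k, B k, Ψ p / 2 ≤ ‖φ (fun l => (t l : F)) * W t‖ := by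
    intro t ht
    obtain ⟨k, h1, _, h3⟩ := Set.mem_iUnion.1 ht
    have hti : 0 < ‖(t i : F)‖ := norm_pos_iff.2 (t i).ne_zero
    have h4 : ‖(t i : F)‖ ≤ η / 2 := by
      have : (1 : ℝ) ≤ 2 ^ k := one_le_pow₀ one_le_two
      nlinarith
    have hη1 : η ≤ 1 := min_le_right _ _
    have hd : dist (fun l => (t l : F)) p < ε := by
      refine lt_of_lt_of_le ((dist_pi_lt_iff hη0).2 fun l => ?_) (min_le_left _ _)
      by_cases hl : l = i
      · subst hl
        rw [hpdef, Function.update_self, dist_zero_right]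
        linarith
      · rw [hpl l hl, dist_eq_norm]
        exact h1 l hl
    have h5 := (hε hd).le
    have h6 : 1 ≤ ‖(t i : F)‖ ^ a i :=
      Real.one_le_rpow_of_pos_of_le_one_of_nonpos hti (by linarith) hai
    rw [norm_mul, hW, ← Finset.mul_prod_erase _ _ (Finset.mem_univ i)]
    calc Ψ p / 2 ≤ Ψ (fun l => (t l : F)) := h5
      _ ≤ Ψ (fun l => (t l : F)) * ‖(t i : F)‖ ^ a i :=
          le_mul_of_one_le_right (by simp only [hΨ]; positivity) h6
      _ = _ := by simp only [hΨ]; ring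
  have hfin := hint.measure_norm_ge_lt_top (half_pos hΨp)
  have hinf : μT (⋃ k, B k) = ⊤ := by
    rw [measure_iUnion hdisj fun k => (hBo k).measurableSet]
    simp only [hBμ]
    exact ENNReal.tsum_const_eq_top_of_ne_zero hB0
  exact (lt_of_le_of_lt (measure_mono hlower) hfin).ne hinf

end

/-! ### Correcting `φ` so that convergence forces positive exponents. -/

section

variable {F : Type*} [RCLike F] {m : ℕ}

theorem integrable_schwartz_mul {μT : Measure (Torus F m)} {χ : Torus F m →ₜ* ℂˣ} {s : ℂ} {N : ℕ}
    (hN : Integrable (fun t : Torus F m =>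
      ((1 + ‖fun i => (t i : F)‖) ^ N)⁻¹ * ‖torusWeight χ s t‖) μT) (h : 𝓢(Fin m → F, ℂ)) :
    Integrable (fun t : Torus F m => h (fun i => (t i : F)) * torusWeight χ s t) μT := by
  set C := 2 ^ N * (Finset.Iic (N, 0)).sup (fun m => SchwartzMap.seminorm ℝ m.1 m.2) h
  refine (hN.const_mul C).mono' ((h.continuous.comp continuous_torus_val).mul
    (continuous_torusWeight χ s)).aestronglyMeasurable (Filter.Eventually.of_forall fun t => ?_)
  have hb := SchwartzMap.one_add_le_sup_seminorm_apply (𝕜 := ℝ) (m := (N, 0)) le_rfl le_rfl h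
    (fun i => (t i : F))
  rw [norm_iteratedFDeriv_zero] at hb
  rw [norm_mul, ← mul_assoc]
  gcongr
  rw [← div_eq_mul_inv, le_div_iff₀ (by positivity), mul_comm]
  exact hb

/-- The sign change of one coordinate. -/
def flipCoord (F : Type*) [RCLike F] (j : Fin m) : (Fin m → F) ≃L[ℝ] (Fin m → F) :=
  ContinuousLinearEquiv.piCongrRight fun l =>
    if l = j then ContinuousLinearEquiv.neg ℝ else ContinuousLinearEquiv.refl ℝ F

theorem flipCoord_apply (j : Fin m) (x : Fin m → F) (l : Fin m) :
    flipCoord F j x l = if l = j then -x l else x l := by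
  rw [flipCoord, ContinuousLinearEquiv.piCongrRight_apply]
  split_ifs <;> rfl

theorem flipCoord_torus (j : Fin m) (t : Torus F m) :
    flipCoord F j (fun i => (t i : F)) = fun i => ((Pi.mulSingle j (-1) * t : Torus F m) i : F) := by
  funext l
  rw [flipCoord_apply, Pi.mul_apply]
  split_ifs with h
  · subst h
    simp
  · rw [Pi.mulSingle_eq_of_ne h, one_mul]

/-- There is a Schwartz function not vanishing at a given point of a coordinate hyperplane, whose
zeta integral vanishes identically. -/
theorem exists_schwartzMap_zeta_eq_zero (μT : Measure (Torus F m)) [μT.IsHaarMeasure]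
    (χ : Torus F m →ₜ* ℂˣ) {i j : Fin m} (hij : j ≠ i) :
    ∃ ψ : 𝓢(Fin m → F, ℂ), ψ (Function.update 1 i 0) ≠ 0 ∧
      ∀ s : ℂ, (∀ h : 𝓢(Fin m → F, ℂ),
          Integrable (fun t : Torus F m => h (fun i => (t i : F)) * torusWeight χ s t) μT) →
        ∫ t : Torus F m, ψ (fun i => (t i : F)) * torusWeight χ s t ∂μT = 0 := by
  set p : Fin m → F := Function.update 1 i 0 with hp
  set ε : Torus F m := Pi.mulSingle j (-1) with hε
  -- The support has radius `1`, while changing the sign of the `j`-th coordinate, which is `1`,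
  -- moves `p` by `2`. So `h` is `1` at `p` and vanishes at its reflection.
  let b : ContDiffBump p := ⟨1 / 2, 1, by norm_num, by norm_num⟩
  set h : 𝓢(Fin m → F, ℂ) := HasCompactSupport.toSchwartzMap (f := fun x => ((b x : ℝ) : ℂ))
    (b.hasCompactSupport.comp_left Complex.ofReal_zero)
    (Complex.ofRealCLM.contDiff.comp b.contDiff) with hh
  set h' : 𝓢(Fin m → F, ℂ) := SchwartzMap.compCLMOfContinuousLinearEquiv ℝ (flipCoord F j) h
    with hh'
  have hh'_apply : ∀ x, h' x = h (flipCoord F j x) := fun x => rfl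
  have hpj : p j = 1 := by rw [hp, Function.update_of_ne hij]; rfl
  -- The torus weight at `ε t` is `χ ε` times its value at `t`, so the integrand is a function minus
  -- its translate by `ε`, and invariance of `μT` gives zero.
  refine ⟨h - (χ ε : ℂ) • h', ?_, fun s hs => ?_⟩
  · have h1 : h p = 1 := by
      change ((b p : ℝ) : ℂ) = 1
      rw [b.one_of_mem_closedBall (Metric.mem_closedBall_self (by norm_num)), Complex.ofReal_one]
    have h2 : h (flipCoord F j p) = 0 := by
      change ((b (flipCoord F j p) : ℝ) : ℂ) = 0
      rw [b.zero_of_le_dist, Complex.ofReal_zero]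
      refine le_trans ?_ (dist_le_pi_dist (flipCoord F j p) p j)
      rw [flipCoord_apply, if_pos rfl, hpj, dist_eq_norm,
        show (-1 : F) - 1 = -2 by norm_num, norm_neg, RCLike.norm_ofNat]
      norm_num
    rw [sub_apply, smul_apply, hh'_apply, h1, h2]
    simp
  · have hεε : ε * ε = 1 := by
      rw [hε, ← Pi.mulSingle_mul]; simp
    have hχε : (χ ε : ℂ) * (χ ε : ℂ) = 1 := by
      rw [← Units.val_mul, ← map_mul, hεε, map_one, Units.val_one]
    have hW : ∀ t, torusWeight χ s (ε * t) = (χ ε : ℂ) * torusWeight χ s t := by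
      intro t
      have hD : detAbs (ε * t) = detAbs t := by
        refine Finset.prod_congr rfl fun l _ => ?_
        rw [Pi.mul_apply, Units.val_mul, modAbs_mul]
        by_cases hl : l = j
        · subst hl
          simp [hε, modAbs]
        · rw [hε, Pi.mulSingle_eq_of_ne hl]
          simp [modAbs]
      rw [torusWeight, torusWeight, hD, map_mul, Units.val_mul, mul_assoc]
    have hfun : ∀ t : Torus F m, (h - (χ ε : ℂ) • h') (fun i => (t i : F)) * torusWeight χ s t =
        h (fun i => (t i : F)) * torusWeight χ s t -
          h (fun i => ((ε * t) i : F)) * torusWeight χ s (ε * t) := by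
      intro t
      rw [sub_apply, smul_apply, hh'_apply, flipCoord_torus, hW, smul_eq_mul]
      ring
    simp only [hfun]
    rw [integral_sub (hs h) ((hs h).comp_mul_left ε)]
    rw [integral_mul_left_eq_self (μ := μT)
      (fun t => h (fun i => (t i : F)) * torusWeight χ s t) ε, sub_self]

/-- Convergence for the given `φ` alone may hold where unfolding is unavailable; the corrected
function rules this out. The correction needs a second coordinate, whence `m ≠ 1`. -/
theorem exists_schwartzMap_zeta_eq_of_integrable (hm : m ≠ 1) (μT : Measure (Torus F m))
    [μT.IsHaarMeasure] (μK : Measure (maxCompact F m)) [μK.IsHaarMeasure]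
    (μG : Measure (GL (Fin m) F)) [μG.IsHaarMeasure] {χ : Torus F m →ₜ* ℂˣ}
    (v : principalSeriesSpace χ) (w : principalSeriesSpace χ⁻¹)
    (Φ : 𝓢(Matrix (Fin m) (Fin m) F, ℂ)) :
    ∃ φ : 𝓢(Fin m → F, ℂ), ∀ s : ℂ,
      Integrable (fun t : Torus F m => φ (fun i => (t i : F)) * torusWeight χ s t) μT →
      Integrable (fun g : GL (Fin m) F => Φ g.val * (∫ k : maxCompact F m, v.1 (k * g) * w.1 k ∂μK) *
          (modAbs g.val.det : ℂ) ^ (s + (m / 2 - 1 / 2))) μG ∧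
      ∫ g : GL (Fin m) F, Φ g.val * (∫ k : maxCompact F m, v.1 (k * g) * w.1 k ∂μK) *
          (modAbs g.val.det : ℂ) ^ (s + (m / 2 - 1 / 2)) ∂μG =
        ∫ t : Torus F m, φ (fun i => (t i : F)) * torusWeight χ s t ∂μT := by
  obtain ⟨φ, hφ⟩ := exists_schwartzMap_zeta_eq μT μK μG v w Φ
  obtain ⟨σ, hσ⟩ := exists_norm_character_eq χ
  have hgood : ∀ s : ℂ, (∀ i, 0 < σ i + Module.finrank ℝ F * s.re) →
      ∃ N : ℕ, Integrable (fun t : Torus F m =>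
        ((1 + ‖fun i => (t i : F)‖) ^ N)⁻¹ * ‖torusWeight χ s t‖) μT := by
    intro s hs
    obtain ⟨N, hN⟩ := exists_integrable_torus μT hs
    exact ⟨N, by simpa only [norm_torusWeight hσ] using hN⟩
  rcases Nat.eq_zero_or_pos m with rfl | hm0
  -- There are no exponents, so the positivity condition is vacuous.
  · exact ⟨φ, fun s _ => (hφ s (hgood s fun i => i.elim0)).2⟩
  have : Nonempty (Fin m) := ⟨⟨0, hm0⟩⟩
  -- The shift by `Re s` is the same in all coordinates, so positivity at a minimal `σ i` implies
  -- positivity everywhere.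
  obtain ⟨i, hi⟩ := Finite.exists_min σ
  have hall : ∀ φ' : 𝓢(Fin m → F, ℂ), φ' (Function.update 1 i 0) ≠ 0 → ∀ s : ℂ,
      Integrable (fun t : Torus F m => φ' (fun i => (t i : F)) * torusWeight χ s t) μT →
      ∀ l, 0 < σ l + Module.finrank ℝ F * s.re := by
    intro φ' hφ' s hs l
    have := exponent_pos_of_integrable μT φ'.continuous hφ'
      (fun t => norm_torusWeight hσ s t) hs
    linarith [hi l]
  by_cases hp : φ (Function.update 1 i 0) = 0
  · have : Nontrivial (Fin m) := Fin.nontrivial_iff_two_le.2 (by omega)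
    obtain ⟨j, hj⟩ := exists_ne i
    obtain ⟨ψ, hψ, hψ0⟩ := exists_schwartzMap_zeta_eq_zero μT χ hj
    refine ⟨φ + ψ, fun s hs => ?_⟩
    obtain ⟨N, hN⟩ := hgood s (hall (φ + ψ) (by rwa [add_apply, hp, zero_add]) s hs)
    obtain ⟨h1, h2, h3⟩ := hφ s ⟨N, hN⟩
    refine ⟨h2, ?_⟩
    rw [h3]
    simp only [add_apply, add_mul]
    rw [integral_add h1 (integrable_schwartz_mul hN ψ),
      hψ0 s fun h => integrable_schwartz_mul hN h, add_zero]
  · exact ⟨φ, fun s hs => (hφ s (hgood s (hall φ hp s hs))).2⟩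

end

end

end GodementJacquet

theorem lemma3p6 {F : Type*} [RCLike F] (n : ℕ)
    (χ : GodementJacquet.Torus F (2 * n) →ₜ* ℂˣ)
    (μG : Measure (GL (Fin (2 * n)) F)) [μG.IsHaarMeasure]
    (μT : Measure (GodementJacquet.Torus F (2 * n))) [μT.IsHaarMeasure]
    (μK : Measure (GodementJacquet.maxCompact F (2 * n))) [μK.IsHaarMeasure]
    (v : GodementJacquet.principalSeriesSpace χ)
    (ξ : Module.Dual ℂ (GodementJacquet.principalSeriesSpace χ))
    (hξ : GodementJacquet.IsContragredientVector χ μK ξ)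
    (Φ : 𝓢(Matrix (Fin (2 * n)) (Fin (2 * n)) F, ℂ)) :
    ∃ φ : 𝓢(Fin (2 * n) → F, ℂ), ∀ s : ℂ,
      Integrable (fun t : GodementJacquet.Torus F (2 * n) =>
        φ (fun i => (t i : F)) * (χ t : ℂ) *
          (GodementJacquet.modAbs (GodementJacquet.diag t).val.det : ℂ) ^ s) μT →
      Integrable (fun g : GL (Fin (2 * n)) F =>
        Φ g.val * ξ (GodementJacquet.principalSeries χ g v) *
          (GodementJacquet.modAbs g.val.det : ℂ) ^ (s + n - 1 / 2)) μG ∧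
      ∫ g : GL (Fin (2 * n)) F, Φ g.val * ξ (GodementJacquet.principalSeries χ g v) *
          (GodementJacquet.modAbs g.val.det : ℂ) ^ (s + n - 1 / 2) ∂μG =
        ∫ t : GodementJacquet.Torus F (2 * n), φ (fun i => (t i : F)) * (χ t : ℂ) *
          (GodementJacquet.modAbs (GodementJacquet.diag t).val.det : ℂ) ^ s ∂μT := by
  obtain ⟨w, hw⟩ := hξ
  -- Evenness of the size `2n` is used only to exclude `m = 1`.
  obtain ⟨φ, hφ⟩ := GodementJacquet.exists_schwartzMap_zeta_eq_of_integrable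
    (show 2 * n ≠ 1 by omega) μT μK μG v w Φ
  have hT : ∀ (s : ℂ) (t : GodementJacquet.Torus F (2 * n)),
      φ (fun i => (t i : F)) * (χ t : ℂ) *
        (GodementJacquet.modAbs (GodementJacquet.diag t).val.det : ℂ) ^ s =
      φ (fun i => (t i : F)) * GodementJacquet.torusWeight χ s t := fun s t => by
    rw [GodementJacquet.modAbs_det_diag, GodementJacquet.torusWeight, mul_assoc]
  have hG : ∀ (s : ℂ) (g : GL (Fin (2 * n)) F),
      Φ g.val * ξ (GodementJacquet.principalSeries χ g v) *
        (GodementJacquet.modAbs g.val.det : ℂ) ^ (s + n - 1 / 2) =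
      Φ g.val * (∫ k : GodementJacquet.maxCompact F (2 * n), v.1 (k * g) * w.1 k ∂μK) *
        (GodementJacquet.modAbs g.val.det : ℂ) ^ (s + ((2 * n : ℕ) / 2 - 1 / 2)) := fun s g => by
    have he : s + n - 1 / 2 = s + (((2 * n : ℕ) : ℂ) / 2 - 1 / 2) := by
      push_cast; ring
    rw [hw, he]
    rfl
  refine ⟨φ, fun s hs => ?_⟩
  simp only [hT] at hs ⊢
  simp only [hG]
  exact hφ s hs
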